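/- **Setting.** Let $\mathcal H=\{H_i\}_{i\in I}$ be a finite family of half-spaces $H_i=\{x\in\mathbb R^d:\langle a_i,x\rangle\le b_i\}$ with $a_i\neq 0$. Let $S\subset\mathbb R^d$ be non-empty and convex, and let $f$ be a real function whose domain contains $\overline S$ and a neighbourhood of each point of $S$. For $x\in\overline S$, $y\in S$ put $D_f(x,y)=f(x)-f(y)-\langle\nabla f(y),x-y\rangle$. Assume: 1. $f$ is a Bregman function with zone $S$ ($f\in\mathcal B(S)$): $f$ is continuous and strictly convex on $\overline S$ and is continuously differentiable on $S$ (differentiable at every point of $S$, with $\nabla f$ continuous on $S$); for all $\alpha\in\mathbb R$, $x\in\overline S$, $y\in S$ the sets $\{u\in\overline S: D_f(u,y)\le\alpha\}$ and $\{v\in S:D_f(x,v)\le\alpha\}$ are bounded; if $y_n\in S$ and $y_n\to y^*$, then $D_f(y^*,y_n)\to0$; if $x_n\in\overline S$ is bounded, $y_n\in S$, $y_n\to y^*$ and $D_f(x_n,y_n)\to0$, then $x_n\to y^*$. 2. Every boundary hyperplane $\{x:\langle a_i,x\rangle=b_i\}$ is strongly zone consistent with respect to $f$ and $S$: for every $y\in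 S$ and every real $\beta$ in the closed interval between $\langle a_i,y\rangle$ and $b_i$, the Bregman projection of $y$ onto $\{q:\langle a_i,q\rangle=\beta\}$ (the minimizer of $D_f(\cdot,y)$ over the points of $\overline S$ on this hyperplane) exists and lies in $S$. 3. The feasible set $C=\overline S\cap\bigcap_i H_i$ is non-empty. 4. There is $x^0\in S$ with $\nabla f(x^0)=0$. 5. $\mathcal Q$ is a random separation oracle: on input $x\in\mathbb R^d$ it returns a random finite list of (indices of) constraints whose law depends only on $x$; the lengths of the lists are bounded by a constant, and there is $\tau>0$ such that for every input $x$ and every $i$ the constraint $H_i$ is on the list with probability at least $\tau$. **Truly stochastic algorithm.** Start with $x^{0}\in S$ such that $\nabla f(x^0)=0$ and with $z^0=0\in\mathbb R^I$. In iteration $\nu=0,1,2,\dots$ a fresh list $L_\nu$ is drawn from $\mathcal Q(x^\nu)$: conditionally on $L_0,\dots,L_{\nu-1}$ it has the law of $\mathcal Q(x^\nu)$. Set $(x,z)=(x^\nu,z^\nu)$ and, for each constraint $i$ of $L_\nu$ in turn (no constraint of earlier iterations is used), find $p\in S$ and $\theta\in\mathbb R$ with $\nabla f(p)-\nabla f(x)=\theta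 a_i$ and $\langle a_i,p\rangle=b_i$, put $c=\min(z_i,\theta)$, replace $x$ by the point $x'\in S$ with $\nabla f(x')-\nabla f(x)=c\,a_i$, and replace $z_i$ by $z_i-c$. The final $(x,z)$ is $(x^{\nu+1},z^{\nu+1})$; in particular the dual variables are kept. **Theorem.** The problem of minimizing $f$ over $C$ has exactly one solution $x^*$, and with probability $1$ every sequence produced by the truly stochastic algorithm converges to $x^*$; this holds for the iterates $x^\nu$ and for the whole sequence of points obtained after the single projections. If moreover $f$ is twice differentiable at $x^*$ and its Hessian $H$ at $x^*$ is positive definite, then there is $\rho\in(0,1)$, which does not depend on the run of the algorithm, such that with probability $1$ $$\liminf_{\nu\to\infty}\frac{\|x^*-x^{\nu+1}\|_H}{\|x^*-x^{\nu}\|_H}\le\rho ,\qquad \|y\|_H^2=y^{T}Hy,$$ where a quotient $0/0$ is read as $0$ and a quotient $r/0$ with $r>0$ as $+\infty$. -/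

import Mathlib

open Set Filter Topology MeasureTheory

open scoped ENNReal

noncomputable section

namespace ProjectForget

/-- Generalized Bregman distance `D_f(x, y) = f x - f y - ⟨∇ f y, x - y⟩`. -/
def bregmanDist {d : ℕ} (f : EuclideanSpace ℝ (Fin d) → ℝ) (x y : EuclideanSpace ℝ (Fin d)) : ℝ :=
  f x - f y - inner ℝ (gradient f y) (x - y)

/-- `f` is a Bregman function with zone `S`. The domain of `f` is `closure S`: its values elsewhere
play no role (beyond differentiability at the points of `S`). -/
structure IsBregmanFunction {d : ℕ} (f : EuclideanSpace ℝ (Fin d) → ℝ)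
    (S : Set (EuclideanSpace ℝ (Fin d))) : Prop where
  nonempty : S.Nonempty
  convex : Convex ℝ S
  continuousOn : ContinuousOn f (closure S)
  strictConvexOn : StrictConvexOn ℝ (closure S) f
  differentiableAt : ∀ x ∈ S, DifferentiableAt ℝ f x
  continuousOn_gradient : ContinuousOn (gradient f) S
  isBounded_left : ∀ y ∈ S, ∀ α : ℝ,
    Bornology.IsBounded {x | x ∈ closure S ∧ bregmanDist f x y ≤ α}
  isBounded_right : ∀ x ∈ closure S, ∀ α : ℝ,
    Bornology.IsBounded {y | y ∈ S ∧ bregmanDist f x y ≤ α}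
  tendsto_bregmanDist : ∀ (y : ℕ → EuclideanSpace ℝ (Fin d)) (y' : EuclideanSpace ℝ (Fin d)),
    (∀ n, y n ∈ S) → Tendsto y atTop (𝓝 y') →
    Tendsto (fun n => bregmanDist f y' (y n)) atTop (𝓝 0)
  tendsto_of_bregmanDist : ∀ (x y : ℕ → EuclideanSpace ℝ (Fin d)) (y' : EuclideanSpace ℝ (Fin d)),
    (∀ n, x n ∈ closure S) → (∀ n, y n ∈ S) →
    Tendsto (fun n => bregmanDist f (x n) (y n)) atTop (𝓝 0) →
    Tendsto y atTop (𝓝 y') → Bornology.IsBounded (range x) → Tendsto x atTop (𝓝 y')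

/-- `p` is the Bregman projection of `y` onto the hyperplane `{q | ⟨a, q⟩ = β}`. -/
def IsBregmanProjection {d : ℕ} (f : EuclideanSpace ℝ (Fin d) → ℝ)
    (S : Set (EuclideanSpace ℝ (Fin d))) (a : EuclideanSpace ℝ (Fin d)) (β : ℝ)
    (y p : EuclideanSpace ℝ (Fin d)) : Prop :=
  p ∈ closure S ∧ inner ℝ a p = β ∧
    ∀ q ∈ closure S, inner ℝ a q = β → bregmanDist f p y ≤ bregmanDist f q y

/-- The hyperplane `{q | ⟨a, q⟩ = b}` is strongly zone consistent with respect to `f` and `S`: for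
`y ∈ S`, the Bregman projection of `y` onto each parallel hyperplane `{q | ⟨a, q⟩ = β}` between `y`
and the given one (the latter included) lies in `S`. -/
def StronglyZoneConsistent {d : ℕ} (f : EuclideanSpace ℝ (Fin d) → ℝ)
    (S : Set (EuclideanSpace ℝ (Fin d))) (a : EuclideanSpace ℝ (Fin d)) (b : ℝ) : Prop :=
  ∀ y ∈ S, ∀ β ∈ uIcc (inner ℝ a y) b, ∃ p ∈ S, IsBregmanProjection f S a β y p

/-- The feasible points: points of the domain `closure S` of the objective function that satisfy
all the constraints `⟨a i, x⟩ ≤ b i`. -/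
def feasibleSet {d : ℕ} {ι : Type*} (S : Set (EuclideanSpace ℝ (Fin d)))
    (a : ι → EuclideanSpace ℝ (Fin d)) (b : ι → ℝ) : Set (EuclideanSpace ℝ (Fin d)) :=
  {x | x ∈ closure S ∧ ∀ i, inner ℝ (a i) x ≤ b i}

/-- `x` minimizes `f` over the feasible points. -/
def IsOptimal {d : ℕ} {ι : Type*} (f : EuclideanSpace ℝ (Fin d) → ℝ)
    (S : Set (EuclideanSpace ℝ (Fin d))) (a : ι → EuclideanSpace ℝ (Fin d)) (b : ι → ℝ)
    (x : EuclideanSpace ℝ (Fin d)) : Prop :=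
  x ∈ feasibleSet S a b ∧ ∀ y ∈ feasibleSet S a b, f x ≤ f y

/-- A random separation oracle. On input `x` it returns a random list of constraints with law
`Q x`; the lists have bounded length, and each constraint is on the list with probability at
least `τ`. -/
def IsRandomSeparationOracle {d : ℕ} {ι : Type*}
    (Q : EuclideanSpace ℝ (Fin d) → PMF (List ι)) : Prop :=
  (∃ R : ℕ, ∀ x, ∀ l ∈ (Q x).support, l.length ≤ R) ∧
    ∃ τ : ℝ≥0∞, 0 < τ ∧ ∀ x i, τ ≤ (Q x).toOuterMeasure {l | i ∈ l}

/-- One pass through the loop of `Project`, for the constraint `i`: the primal and dual variables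
`x, z` become `x', z'`. Here `p` is the projection of `x` onto the hyperplane of the constraint. -/
def ProjectStep {d : ℕ} {ι : Type*} [DecidableEq ι] (f : EuclideanSpace ℝ (Fin d) → ℝ)
    (S : Set (EuclideanSpace ℝ (Fin d))) (a : ι → EuclideanSpace ℝ (Fin d)) (b : ι → ℝ) (i : ι)
    (x : EuclideanSpace ℝ (Fin d)) (z : ι → ℝ)
    (x' : EuclideanSpace ℝ (Fin d)) (z' : ι → ℝ) : Prop :=
  ∃ p ∈ S, ∃ θ : ℝ,
    gradient f p - gradient f x = θ • a i ∧ inner ℝ (a i) p = b i ∧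
    x' ∈ S ∧ gradient f x' - gradient f x = min (z i) θ • a i ∧
    z' = Function.update z i (z i - min (z i) θ)

/-- `x ν j` and `z ν j` are the primal and dual variables of the truly stochastic algorithm
after `j` projections of iteration `ν`, when the oracle returns the list `l ν` in iteration `ν`.
The iterates are `x ν 0`. No constraint is remembered from one iteration to the next, but the dual
variables are kept. -/
structure IsTrajectory {d : ℕ} {ι : Type*} [DecidableEq ι] (f : EuclideanSpace ℝ (Fin d) → ℝ)
    (S : Set (EuclideanSpace ℝ (Fin d))) (a : ι → EuclideanSpace ℝ (Fin d)) (b : ι → ℝ)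
    (l : ℕ → List ι) (x : ℕ → ℕ → EuclideanSpace ℝ (Fin d)) (z : ℕ → ℕ → ι → ℝ) : Prop where
  init_mem : x 0 0 ∈ S
  init_gradient : gradient f (x 0 0) = 0
  init_dual : z 0 0 = 0
  project : ∀ (ν j : ℕ) (hj : j < (l ν).length),
    ProjectStep f S a b ((l ν)[j]) (x ν j) (z ν j) (x ν (j + 1)) (z ν (j + 1))
  next_primal : ∀ ν, x (ν + 1) 0 = x ν (l ν).length
  next_dual : ∀ ν, z (ν + 1) 0 = z ν (l ν).length

/-- A run of the truly stochastic algorithm with oracle `Q` on a probability space: `L ν` is the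
random list returned in iteration `ν`. Given the lists of the previous iterations, `L ν` has law
`Q` at the current iterate. -/
structure IsStochasticRun {d : ℕ} {ι : Type*} [DecidableEq ι]
    (f : EuclideanSpace ℝ (Fin d) → ℝ) (S : Set (EuclideanSpace ℝ (Fin d)))
    (a : ι → EuclideanSpace ℝ (Fin d)) (b : ι → ℝ)
    (Q : EuclideanSpace ℝ (Fin d) → PMF (List ι))
    {Ω : Type*} [MeasurableSpace Ω] (μ : Measure Ω) (L : ℕ → Ω → List ι)
    (x : ℕ → ℕ → Ω → EuclideanSpace ℝ (Fin d)) (z : ℕ → ℕ → Ω → ι → ℝ) : Prop where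
  isTrajectory : ∀ ω, IsTrajectory f S a b (fun ν => L ν ω) (fun ν j => x ν j ω)
    (fun ν j => z ν j ω)
  measurableSet : ∀ ν l, MeasurableSet {ω | L ν ω = l}
  law : ∀ ν ω₀ l,
    μ {ω | (∀ k < ν, L k ω = L k ω₀) ∧ L ν ω = l} =
      μ {ω | ∀ k < ν, L k ω = L k ω₀} * Q (x ν 0 ω₀) l

/-- `f` is twice differentiable at `x`. -/
def TwiceDifferentiableAt {d : ℕ} (f : EuclideanSpace ℝ (Fin d) → ℝ)
    (x : EuclideanSpace ℝ (Fin d)) : Prop :=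
  (∀ᶠ y in 𝓝 x, DifferentiableAt ℝ f y) ∧ DifferentiableAt ℝ (fderiv ℝ f) x

/-- The quadratic form `v ↦ vᵀ H v` of the Hessian `H` of `f` at `x`. -/
def hessianForm {d : ℕ} (f : EuclideanSpace ℝ (Fin d) → ℝ) (x v : EuclideanSpace ℝ (Fin d)) : ℝ :=
  fderiv ℝ (fderiv ℝ f) x v v

/-- `‖v‖_H = √(vᵀ H v)`, where `H` is the Hessian of `f` at `x`. -/
def hessianNorm {d : ℕ} (f : EuclideanSpace ℝ (Fin d) → ℝ) (x v : EuclideanSpace ℝ (Fin d)) : ℝ :=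
  √(hessianForm f x v)

end ProjectForget

end

/-! ### Bregman distances and existence of the optimum. -/

namespace ProjectForget

variable {d : ℕ} {f : EuclideanSpace ℝ (Fin d) → ℝ} {S : Set (EuclideanSpace ℝ (Fin d))}

/-! Each projection is a step of dual coordinate ascent. The invariant `∇f(x) = -∑ z i • a i` with
`z ≥ 0` makes `x` a minimizer of the Lagrangian with multipliers `z`, so `dualityGap` is `f(q)`
minus the dual value. A projection lowers the gap by at least `D_f(x', x)`. For feasible `q` the gap
is non-negative, hence iterates stay bounded and successive Bregman distances tend to `0`.

Convergence needs only that, infinitely often, some window of fixed length `M` processes every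
constraint. Take a limit `x` along such windows. In the window each constraint is either met with
equality or satisfied with a multiplier that is still zero at the end. So `x` is feasible and
complementary, the gap at `x` tends to `0` along the windows, and by monotonicity everywhere
(`tendsto_of_frequently_coversAll`).

For the rate, multipliers of inactive constraints eventually vanish, so the gap at the optimum
becomes `D_f(x*, X n)`, about half the squared Hessian norm of the error. Over a covering window its
decrease dominates the squared step lengths up to a Taylor error, while these lengths control the
final error, since the gradient is spanned by normals of constraints that were tight during the
window. Hence `exists_eventually_hessianForm_le`: the window contracts by a fixed factor, and one of
its iterations contracts by a root of it.

Randomness enters only through covering windows: whatever the past, the next iterations list the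
constraints one after another with probability bounded below, so this almost surely recurs
(`ae_frequently_forall_mem`). -/

lemma inner_gradient_eq_fderiv (f : EuclideanSpace ℝ (Fin d) → ℝ)
    (x v : EuclideanSpace ℝ (Fin d)) : inner ℝ (gradient f x) v = fderiv ℝ f x v := by
  rw [gradient, InnerProductSpace.toDual_symm_apply]

lemma bregmanDist_eq_fderiv (f : EuclideanSpace ℝ (Fin d) → ℝ)
    (x y : EuclideanSpace ℝ (Fin d)) :
    bregmanDist f x y = f x - f y - fderiv ℝ f y (x - y) := by
  rw [bregmanDist, inner_gradient_eq_fderiv]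

/-- The three-point identity. -/
lemma bregmanDist_sub_bregmanDist (f : EuclideanSpace ℝ (Fin d) → ℝ)
    (q x y : EuclideanSpace ℝ (Fin d)) :
    bregmanDist f q x - bregmanDist f q y =
      bregmanDist f y x + inner ℝ (gradient f y - gradient f x) (q - y) := by
  have h : q - x = (q - y) + (y - x) := by abel
  simp only [bregmanDist, h, inner_add_right, inner_sub_left]
  ring

lemma bregmanDist_self (f : EuclideanSpace ℝ (Fin d) → ℝ) (x : EuclideanSpace ℝ (Fin d)) :
    bregmanDist f x x = 0 := by
  simp [bregmanDist]

namespace IsBregmanFunction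

variable {x y : EuclideanSpace ℝ (Fin d)}

lemma bregmanDist_nonneg (hf : IsBregmanFunction f S) (hx : x ∈ closure S) (hy : y ∈ S) :
    0 ≤ bregmanDist f x y := by
  have hline : HasDerivAt (fun t : ℝ => y + t • (x - y)) (x - y) 0 := by
    simpa using ((hasDerivAt_id (0 : ℝ)).smul_const (x - y)).const_add y
  have hd : HasDerivAt (fun t : ℝ => f (y + t • (x - y))) (fderiv ℝ f y (x - y)) 0 := by
    have h1 : HasFDerivAt f (fderiv ℝ f y) (y + (0 : ℝ) • (x - y)) := by
      simpa using (hf.differentiableAt y hy).hasFDerivAt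
    exact h1.comp_hasDerivAt (0 : ℝ) hline
  -- One-sided slopes suffice and are all that convexity controls: only the part of the line from
  -- `y` to `x` is known to lie in `closure S`.
  have hslope := hd.tendsto_slope_zero_right
  have hle : fderiv ℝ f y (x - y) ≤ f x - f y := by
    refine le_of_tendsto hslope ?_
    filter_upwards [Ioo_mem_nhdsGT (zero_lt_one' ℝ)] with t ht
    have hc := hf.strictConvexOn.convexOn.2 (subset_closure hy) hx
      (show 0 ≤ 1 - t by linarith [ht.2]) ht.1.le (by ring)
    have he : (1 - t) • y + t • x = y + t • (x - y) := by module
    rw [he] at hc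
    simp only [zero_add, zero_smul, add_zero, smul_eq_mul] at hc ⊢
    rw [inv_mul_le_iff₀ ht.1]
    linarith
  rw [bregmanDist_eq_fderiv]
  linarith

/-- At the midpoint `m`, strict convexity gives `D_f(x, y) > 2 D_f(m, y) ≥ 0`. -/
lemma bregmanDist_pos (hf : IsBregmanFunction f S) (hx : x ∈ closure S) (hy : y ∈ S)
    (hxy : x ≠ y) :
    0 < bregmanDist f x y := by
  have hy' := subset_closure hy
  have hm := hf.strictConvexOn.1 hx hy' (show (0 : ℝ) ≤ 1 / 2 by norm_num)
    (show (0 : ℝ) ≤ 1 / 2 by norm_num) (by norm_num)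
  have hlt := hf.strictConvexOn.2 hx hy' hxy (show (0 : ℝ) < 1 / 2 by norm_num)
    (show (0 : ℝ) < 1 / 2 by norm_num) (by norm_num)
  have h0 := hf.bregmanDist_nonneg hm hy
  have he : (1 / 2 : ℝ) • x + (1 / 2 : ℝ) • y - y = (1 / 2 : ℝ) • (x - y) := by module
  rw [bregmanDist, he, inner_smul_right] at h0
  simp only [smul_eq_mul] at hlt
  rw [bregmanDist]
  linarith

lemma inner_gradient_sub_nonneg (hf : IsBregmanFunction f S) (hx : x ∈ S) (hy : y ∈ S) :
    0 ≤ inner ℝ (gradient f x - gradient f y) (x - y) := by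
  have h1 := bregmanDist_sub_bregmanDist f y y x
  rw [bregmanDist_self, ← neg_sub x y, inner_neg_right] at h1
  linarith [hf.bregmanDist_nonneg (subset_closure hx) hy,
    hf.bregmanDist_nonneg (subset_closure hy) hx]

lemma gradient_injOn (hf : IsBregmanFunction f S) : InjOn (gradient f) S := by
  intro x hx y hy h
  by_contra hxy
  have h1 := bregmanDist_sub_bregmanDist f y y x
  rw [bregmanDist_self, h, sub_self, inner_zero_left] at h1
  linarith [hf.bregmanDist_pos (subset_closure hx) hy hxy,
    hf.bregmanDist_nonneg (subset_closure hy) hx]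

end IsBregmanFunction

variable {ι : Type*} {a : ι → EuclideanSpace ℝ (Fin d)} {b : ι → ℝ}

lemma isClosed_feasibleSet : IsClosed (feasibleSet S a b) := by
  have h : feasibleSet S a b = closure S ∩ ⋂ i, {x | inner ℝ (a i) x ≤ b i} := by
    ext x; simp [feasibleSet]
  rw [h]
  exact isClosed_closure.inter (isClosed_iInter fun i =>
    isClosed_le (continuous_const.inner continuous_id) continuous_const)

lemma convex_feasibleSet (hS : Convex ℝ S) : Convex ℝ (feasibleSet S a b) := by
  have h : feasibleSet S a b = closure S ∩ ⋂ i, {x | inner ℝ (a i) x ≤ b i} := by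
    ext x; simp [feasibleSet]
  rw [h]
  exact hS.closure.inter (convex_iInter fun i =>
    convex_halfSpace_le (innerSL ℝ (a i)).toLinearMap.isLinear (b i))

/-- At a critical point `x₀` the distance `D_f(·, x₀)` is `f - f x₀`, so the boundedness axiom makes
sublevel sets of `f` bounded. -/
lemma IsBregmanFunction.exists_isOptimal (hf : IsBregmanFunction f S)
    (hfeas : (feasibleSet S a b).Nonempty) (hcrit : ∃ x₀ ∈ S, gradient f x₀ = 0) :
    ∃ x, IsOptimal f S a b x := by
  obtain ⟨x₀, hx₀, hg⟩ := hcrit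
  obtain ⟨q, hq⟩ := hfeas
  have hsub : feasibleSet S a b ⊆ closure S := fun x hx => hx.1
  have hcont : ContinuousOn f (feasibleSet S a b) := hf.continuousOn.mono hsub
  set K := {x | x ∈ feasibleSet S a b ∧ f x ≤ f q} with hK
  have hKc : IsCompact K := by
    refine Metric.isCompact_of_isClosed_isBounded ?_ ?_
    · exact hcont.preimage_isClosed_of_isClosed isClosed_feasibleSet isClosed_Iic
    · refine (hf.isBounded_left x₀ hx₀ (f q - f x₀)).subset fun x hx => ⟨hx.1.1, ?_⟩
      rw [bregmanDist, hg, inner_zero_left]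
      linarith [hx.2]
  obtain ⟨x, hx, hmin⟩ := hKc.exists_isMinOn ⟨q, hq, le_rfl⟩ (hcont.mono fun x hx => hx.1)
  refine ⟨x, hx.1, fun y hy => ?_⟩
  by_cases h : f y ≤ f q
  · exact hmin ⟨hy, h⟩
  · exact hx.2.trans (not_le.1 h).le

lemma IsBregmanFunction.isOptimal_unique (hf : IsBregmanFunction f S)
    {x y : EuclideanSpace ℝ (Fin d)} (hx : IsOptimal f S a b x) (hy : IsOptimal f S a b y) :
    x = y :=
  (hf.strictConvexOn.subset (fun _ h => h.1) (convex_feasibleSet hf.convex)).eq_of_isMinOn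
    hx.2 hy.2 hx.1 hy.1

end ProjectForget

/-! ### Descent of the duality gap and deterministic convergence. -/

namespace ProjectForget

variable {d : ℕ} {f : EuclideanSpace ℝ (Fin d) → ℝ} {S : Set (EuclideanSpace ℝ (Fin d))}
  {ι : Type*} {a : ι → EuclideanSpace ℝ (Fin d)} {b : ι → ℝ}

/-- If `θ ≤ z i`, injectivity of the gradient gives `x' = p`, a point of the hyperplane. Otherwise
the multiplier is used up, and monotonicity of the gradient between `x'` and `p` puts `x'` in the
half-space. -/
lemma ProjectStep.exists_shift [DecidableEq ι] (hf : IsBregmanFunction f S) {i : ι}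
    {x x' : EuclideanSpace ℝ (Fin d)} {z z' : ι → ℝ} (h : ProjectStep f S a b i x z x' z')
    (hz : 0 ≤ z i) :
    ∃ c : ℝ, x' ∈ S ∧ gradient f x' - gradient f x = c • a i ∧
      z' = Function.update z i (z i - c) ∧ c ≤ z i ∧ 0 ≤ c * (b i - inner ℝ (a i) x') ∧
      (inner ℝ (a i) x' = b i ∨ inner ℝ (a i) x' ≤ b i ∧ z' i = 0) := by
  obtain ⟨p, hp, θ, hpx, hpb, hx', hg, rfl⟩ := h
  refine ⟨min (z i) θ, hx', hg, rfl, min_le_left _ _, ?_⟩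
  rcases le_or_gt θ (z i) with hθ | hθ
  · rw [min_eq_right hθ] at hg ⊢
    have : x' = p := hf.gradient_injOn hx' hp (sub_left_injective (hg.trans hpx.symm))
    subst this
    simp [hpb]
  · rw [min_eq_left hθ.le] at hg ⊢
    have hm := hf.inner_gradient_sub_nonneg hp hx'
    have he : gradient f p - gradient f x' = (θ - z i) • a i := by
      rw [sub_smul, ← hpx, ← hg]; abel
    rw [he, inner_smul_left, inner_sub_right, hpb] at hm
    have hle : 0 ≤ b i - inner ℝ (a i) x' :=
      nonneg_of_mul_nonneg_right hm (sub_pos.2 hθ)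
    exact ⟨mul_nonneg hz hle, Or.inr ⟨by linarith, by simp⟩⟩

/-- A single sequence of projections, starting from the unconstrained minimizer; at each time
either the constraint `I n` is processed or, when `I n = none`, nothing happens. -/
structure IsProjectChain [DecidableEq ι] (f : EuclideanSpace ℝ (Fin d) → ℝ)
    (S : Set (EuclideanSpace ℝ (Fin d))) (a : ι → EuclideanSpace ℝ (Fin d)) (b : ι → ℝ)
    (I : ℕ → Option ι) (X : ℕ → EuclideanSpace ℝ (Fin d)) (Z : ℕ → ι → ℝ) : Prop where
  init_mem : X 0 ∈ S
  init_gradient : gradient f (X 0) = 0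
  init_dual : Z 0 = 0
  idle : ∀ n, I n = none → X (n + 1) = X n ∧ Z (n + 1) = Z n
  project : ∀ n i, I n = some i → ProjectStep f S a b i (X n) (Z n) (X (n + 1)) (Z (n + 1))

/-- All the constraints are processed at the times `n, …, n + M - 1`. -/
def CoversAll (I : ℕ → Option ι) (M n : ℕ) : Prop :=
  ∀ i, ∃ j < M, I (n + j) = some i

/-- The duality gap of `(x, z)` with respect to the point `q`, when `x` minimizes the Lagrangian
with multipliers `z`. -/
noncomputable def dualityGap [Fintype ι] (f : EuclideanSpace ℝ (Fin d) → ℝ)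
    (a : ι → EuclideanSpace ℝ (Fin d)) (b : ι → ℝ) (q x : EuclideanSpace ℝ (Fin d))
    (z : ι → ℝ) : ℝ :=
  bregmanDist f q x + ∑ i, z i * (b i - inner ℝ (a i) q)

/-- By the three-point identity the decrease is exactly `D_f(x', x) + c (b i - ⟨a i, x'⟩)`, whose
last term is non-negative by the choice of `c`. -/
lemma ProjectStep.bregmanDist_le_dualityGap_sub [Fintype ι] [DecidableEq ι]
    (hf : IsBregmanFunction f S) {i : ι} {x x' : EuclideanSpace ℝ (Fin d)} {z z' : ι → ℝ}
    (h : ProjectStep f S a b i x z x' z') (hz : 0 ≤ z i) (q : EuclideanSpace ℝ (Fin d)) :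
    bregmanDist f x' x ≤ dualityGap f a b q x z - dualityGap f a b q x' z' := by
  obtain ⟨c, -, hg, rfl, -, hc, -⟩ := h.exists_shift hf hz
  have h3 := bregmanDist_sub_bregmanDist f q x x'
  rw [hg, inner_smul_left, inner_sub_right] at h3
  have hsum : ∑ j, z j * (b j - inner ℝ (a j) q) -
      ∑ j, Function.update z i (z i - c) j * (b j - inner ℝ (a j) q) =
      c * (b i - inner ℝ (a i) q) := by
    rw [← Finset.sum_sub_distrib, Finset.sum_eq_single i]
    · simp; ring
    · intro j _ hj
      simp [Function.update_of_ne hj]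
    · simp
  simp only [dualityGap]
  simp only [conj_trivial] at h3
  linarith

namespace IsProjectChain

variable [DecidableEq ι] {I : ℕ → Option ι} {X : ℕ → EuclideanSpace ℝ (Fin d)} {Z : ℕ → ι → ℝ}

lemma mem_and_nonneg (hf : IsBregmanFunction f S) (h : IsProjectChain f S a b I X Z) (n : ℕ) :
    X n ∈ S ∧ 0 ≤ Z n := by
  induction n with
  | zero => exact ⟨h.init_mem, h.init_dual.ge⟩
  | succ n ih =>
    rcases hI : I n with _ | i
    · rwa [(h.idle n hI).1, (h.idle n hI).2]
    · obtain ⟨c, hx, -, hz, hc, -⟩ := (h.project n i hI).exists_shift hf (ih.2 i)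
      refine ⟨hx, fun j => ?_⟩
      rw [hz]
      by_cases hj : j = i
      · subst hj; simpa using hc
      · simpa [Function.update_of_ne hj] using ih.2 j

lemma mem (hf : IsBregmanFunction f S) (h : IsProjectChain f S a b I X Z) (n : ℕ) : X n ∈ S :=
  (h.mem_and_nonneg hf n).1

lemma dual_nonneg (hf : IsBregmanFunction f S) (h : IsProjectChain f S a b I X Z) (n : ℕ)
    (i : ι) : 0 ≤ Z n i :=
  (h.mem_and_nonneg hf n).2 i

lemma gradient_eq [Fintype ι] (hf : IsBregmanFunction f S) (h : IsProjectChain f S a b I X Z)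
    (n : ℕ) : gradient f (X n) = -∑ i, Z n i • a i := by
  induction n with
  | zero => simp [h.init_gradient, h.init_dual]
  | succ n ih =>
    rcases hI : I n with _ | i
    · rwa [(h.idle n hI).1, (h.idle n hI).2]
    · obtain ⟨c, -, hg, hz, -⟩ := (h.project n i hI).exists_shift hf (h.dual_nonneg hf n i)
      have hsum : ∑ j, Z n j • a j - ∑ j, Z (n + 1) j • a j = c • a i := by
        rw [← Finset.sum_sub_distrib, Finset.sum_eq_single i]
        · rw [hz, Function.update_self, ← sub_smul, sub_sub_cancel]
        · intro j _ hj
          simp [hz, Function.update_of_ne hj]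
        · simp
      rw [← hsum, ih] at hg
      rw [sub_eq_iff_eq_add] at hg
      rw [hg]
      abel

lemma bregmanDist_le_dualityGap_sub [Fintype ι] (hf : IsBregmanFunction f S)
    (h : IsProjectChain f S a b I X Z) (q : EuclideanSpace ℝ (Fin d)) (n : ℕ) :
    bregmanDist f (X (n + 1)) (X n) ≤
      dualityGap f a b q (X n) (Z n) - dualityGap f a b q (X (n + 1)) (Z (n + 1)) := by
  rcases hI : I n with _ | i
  · rw [(h.idle n hI).1, (h.idle n hI).2, bregmanDist_self, sub_self]
  · exact (h.project n i hI).bregmanDist_le_dualityGap_sub hf (h.dual_nonneg hf n i) q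

lemma antitone_dualityGap [Fintype ι] (hf : IsBregmanFunction f S)
    (h : IsProjectChain f S a b I X Z) (q : EuclideanSpace ℝ (Fin d)) :
    Antitone fun n => dualityGap f a b q (X n) (Z n) :=
  antitone_nat_of_succ_le fun n => by
    linarith [h.bregmanDist_le_dualityGap_sub hf q n,
      hf.bregmanDist_nonneg (subset_closure (h.mem hf (n + 1))) (h.mem hf n)]

lemma bregmanDist_le_dualityGap [Fintype ι] (hf : IsBregmanFunction f S)
    (h : IsProjectChain f S a b I X Z) {q : EuclideanSpace ℝ (Fin d)}
    (hq : q ∈ feasibleSet S a b) (n : ℕ) :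
    bregmanDist f q (X n) ≤ dualityGap f a b q (X n) (Z n) :=
  le_add_of_nonneg_right <| Finset.sum_nonneg fun i _ =>
    mul_nonneg (h.dual_nonneg hf n i) (sub_nonneg.2 (hq.2 i))

lemma dualityGap_nonneg [Fintype ι] (hf : IsBregmanFunction f S)
    (h : IsProjectChain f S a b I X Z) {q : EuclideanSpace ℝ (Fin d)}
    (hq : q ∈ feasibleSet S a b) (n : ℕ) : 0 ≤ dualityGap f a b q (X n) (Z n) :=
  (hf.bregmanDist_nonneg hq.1 (h.mem hf n)).trans (h.bregmanDist_le_dualityGap hf hq n)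

/-- The dual value, which the gap subtracts from `f`, does not depend on the comparison point. -/
lemma dualityGap_sub_dualityGap [Fintype ι] (hf : IsBregmanFunction f S)
    (h : IsProjectChain f S a b I X Z) (p q : EuclideanSpace ℝ (Fin d)) (n : ℕ) :
    dualityGap f a b p (X n) (Z n) - dualityGap f a b q (X n) (Z n) = f p - f q := by
  have hg : inner ℝ (gradient f (X n)) (p - q) = -∑ i, Z n i * inner ℝ (a i) (p - q) := by
    rw [h.gradient_eq hf n, inner_neg_left, sum_inner]
    simp [inner_smul_left]
  have hpq : p - X n = (p - q) + (q - X n) := by abel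
  simp only [inner_sub_right, mul_sub, Finset.sum_sub_distrib] at hg
  simp only [dualityGap, bregmanDist, hpq, inner_add_right, mul_sub, Finset.sum_sub_distrib]
  rw [inner_sub_right]
  linarith

lemma isBounded_range [Fintype ι] (hf : IsBregmanFunction f S)
    (h : IsProjectChain f S a b I X Z) {q : EuclideanSpace ℝ (Fin d)}
    (hq : q ∈ feasibleSet S a b) : Bornology.IsBounded (range X) := by
  refine (hf.isBounded_right q hq.1 (dualityGap f a b q (X 0) (Z 0))).subset ?_
  rintro _ ⟨n, rfl⟩
  exact ⟨h.mem hf n, (h.bregmanDist_le_dualityGap hf hq n).trans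
    (h.antitone_dualityGap hf q (Nat.zero_le n))⟩

lemma tendsto_bregmanDist_succ [Fintype ι] (hf : IsBregmanFunction f S)
    (h : IsProjectChain f S a b I X Z) {q : EuclideanSpace ℝ (Fin d)}
    (hq : q ∈ feasibleSet S a b) :
    Tendsto (fun n => bregmanDist f (X (n + 1)) (X n)) atTop (𝓝 0) := by
  obtain ⟨l, hl⟩ : ∃ l, Tendsto (fun n => dualityGap f a b q (X n) (Z n)) atTop (𝓝 l) :=
    ⟨_, tendsto_atTop_ciInf (h.antitone_dualityGap hf q)
      ⟨0, by rintro _ ⟨n, rfl⟩; exact h.dualityGap_nonneg hf hq n⟩⟩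
  refine squeeze_zero (fun n =>
    hf.bregmanDist_nonneg (subset_closure (h.mem hf (n + 1))) (h.mem hf n))
    (fun n => h.bregmanDist_le_dualityGap_sub hf q n) ?_
  simpa using hl.sub (hl.comp (tendsto_add_atTop_nat 1))

lemma dual_succ_of_ne (hf : IsBregmanFunction f S) (h : IsProjectChain f S a b I X Z) {i : ι}
    {n : ℕ} (hI : I n ≠ some i) : Z (n + 1) i = Z n i := by
  rcases hI' : I n with _ | i'
  · exact congrFun (h.idle _ hI').2 i
  · obtain ⟨c, -, -, hz, -⟩ := (h.project n i' hI').exists_shift hf (h.dual_nonneg hf _ i')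
    have hne : i ≠ i' := by rintro rfl; exact hI hI'
    rw [hz, Function.update_of_ne hne]

/-- After a constraint has been processed, either it was active at some point of the sequence, or
it was satisfied at some point and its dual variable still vanishes. -/
lemma exists_active_or_dual_eq_zero (hf : IsBregmanFunction f S)
    (h : IsProjectChain f S a b I X Z) {i : ι} {n m : ℕ} (hi : ∃ j < m, I (n + j) = some i) :
    ∃ j ≤ m, inner ℝ (a i) (X (n + j)) = b i ∨
      inner ℝ (a i) (X (n + j)) ≤ b i ∧ Z (n + m) i = 0 := by
  induction m with
  | zero => simp at hi
  | succ m ih =>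
    by_cases hI : I (n + m) = some i
    · obtain ⟨c, -, -, -, -, -, hc⟩ :=
        (h.project (n + m) i hI).exists_shift hf (h.dual_nonneg hf _ i)
      exact ⟨m + 1, le_rfl, hc⟩
    · obtain ⟨j, hj, hij⟩ := hi
      have hjm : j < m := lt_of_le_of_ne (Nat.lt_succ_iff.1 hj) (by rintro rfl; exact hI hij)
      obtain ⟨k, hk, hk'⟩ := ih ⟨j, hjm, hij⟩
      exact ⟨k, hk.trans m.le_succ, by rwa [← add_assoc, h.dual_succ_of_ne hf hI]⟩

/-- The shifts of a convergent subsequence converge to the same limit. -/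
lemma tendsto_comp_add [Fintype ι] (hf : IsBregmanFunction f S)
    (h : IsProjectChain f S a b I X Z) (hfeas : (feasibleSet S a b).Nonempty)
    {φ : ℕ → ℕ} (hφ : StrictMono φ) {x : EuclideanSpace ℝ (Fin d)}
    (hx : Tendsto (fun k => X (φ k)) atTop (𝓝 x)) (j : ℕ) :
    Tendsto (fun k => X (φ k + j)) atTop (𝓝 x) := by
  obtain ⟨q, hq⟩ := hfeas
  induction j with
  | zero => exact hx
  | succ j ih =>
    refine hf.tendsto_of_bregmanDist _ _ _ (fun k => subset_closure (h.mem hf _))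
      (fun k => h.mem hf (φ k + j)) ?_ ih
      ((h.isBounded_range hf hq).subset ?_)
    · exact (h.tendsto_bregmanDist_succ hf hq).comp
        (tendsto_atTop_mono (fun k => (hφ.id_le k).trans (Nat.le_add_right _ j)) tendsto_id)
    · rintro _ ⟨k, rfl⟩
      exact mem_range_self _

lemma tendsto_of_frequently_coversAll [Fintype ι] (hf : IsBregmanFunction f S)
    (h : IsProjectChain f S a b I X Z) (hfeas : (feasibleSet S a b).Nonempty) {M : ℕ}
    (hM : ∃ᶠ n in atTop, CoversAll I M n) {xopt : EuclideanSpace ℝ (Fin d)}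
    (hopt : IsOptimal f S a b xopt) : Tendsto X atTop (𝓝 xopt) := by
  obtain ⟨φ₀, hφ₀, hcov₀⟩ := extraction_of_frequently_atTop hM
  obtain ⟨q, hq⟩ := hfeas
  have hbdd := h.isBounded_range hf hq
  obtain ⟨x, -, ψ, hψ, hx⟩ := tendsto_subseq_of_bounded hbdd (x := fun k => X (φ₀ k))
    fun k => mem_range_self _
  set φ := φ₀ ∘ ψ with hφdef
  have hφ : StrictMono φ := hφ₀.comp hψ
  have hcov : ∀ k, CoversAll I M (φ k) := fun k => hcov₀ (ψ k)
  have hshift := fun j => h.tendsto_comp_add hf ⟨q, hq⟩ hφ hx j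
  have hall : ∀ i, ∀ ε > 0, ∀ᶠ k in atTop, ∀ j ≤ M,
      |inner ℝ (a i) (X (φ k + j)) - inner ℝ (a i) x| < ε := by
    intro i ε hε
    have : ∀ j ∈ Finset.range (M + 1), ∀ᶠ k in atTop,
        |inner ℝ (a i) (X (φ k + j)) - inner ℝ (a i) x| < ε := fun j _ =>
      Metric.tendsto_nhds.1
        (((innerSL ℝ (a i)).continuous.tendsto x).comp (hshift j)) ε hε
    filter_upwards [(Filter.eventually_all_finset _).2 this] with k hk j hj
    exact hk j (Finset.mem_range.2 (Nat.lt_succ_iff.2 hj))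
  have hxS : x ∈ closure S := mem_closure_of_tendsto hx (Eventually.of_forall fun k => h.mem hf _)
  have hxf : x ∈ feasibleSet S a b := by
    refine ⟨hxS, fun i => le_of_forall_pos_le_add fun ε hε => ?_⟩
    obtain ⟨k, hk⟩ := (hall i ε hε).exists
    obtain ⟨j, hj, hij⟩ := h.exists_active_or_dual_eq_zero hf (hcov k i)
    have := abs_lt.1 (hk j hj)
    rcases hij with hij | ⟨hij, -⟩ <;> linarith
  -- If the constraint is slack at `x`, it is slack throughout late windows, so only the alternative
  -- of a zero multiplier remains.
  have hcompl : ∀ i, ∀ᶠ k in atTop, Z (φ k + M) i * (b i - inner ℝ (a i) x) = 0 := by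
    intro i
    rcases (hxf.2 i).eq_or_lt with heq | hlt
    · simp [heq]
    · filter_upwards [hall i _ (sub_pos.2 hlt)] with k hk
      obtain ⟨j, hj, hij⟩ := h.exists_active_or_dual_eq_zero hf (hcov k i)
      have := abs_lt.1 (hk j hj)
      rcases hij with hij | ⟨-, hij⟩
      · linarith
      · rw [hij, zero_mul]
  have hgap : Tendsto (fun k => dualityGap f a b x (X (φ k + M)) (Z (φ k + M))) atTop (𝓝 0) := by
    refine (hf.tendsto_bregmanDist _ x (fun k => h.mem hf _) (hshift M)).congr' ?_
    filter_upwards [Filter.eventually_all.2 hcompl] with k hk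
    simp [dualityGap, hk]
  have hxopt : IsOptimal f S a b x := by
    refine ⟨hxf, fun y hy => ?_⟩
    -- The two gaps differ by `f x - f y`, and the one at the feasible `y` is non-negative.
    have hy' : ∀ k, f x - f y ≤ dualityGap f a b x (X (φ k + M)) (Z (φ k + M)) := fun k => by
      linarith [h.dualityGap_sub_dualityGap hf x y (φ k + M), h.dualityGap_nonneg hf hy (φ k + M)]
    linarith [ge_of_tendsto' hgap hy']
  obtain rfl := hf.isOptimal_unique hopt hxopt
  have hanti := h.antitone_dualityGap hf xopt
  have hdist : Tendsto (fun n => bregmanDist f xopt (X n)) atTop (𝓝 0) := by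
    refine squeeze_zero (fun n => hf.bregmanDist_nonneg hxf.1 (h.mem hf n))
      (h.bregmanDist_le_dualityGap hf hxf) ?_
    have hl := tendsto_atTop_ciInf hanti
      ⟨0, by rintro _ ⟨n, rfl⟩; exact h.dualityGap_nonneg hf hxf n⟩
    have hsub : Tendsto (fun k => φ k + M) atTop atTop :=
      tendsto_atTop_mono (fun k => (hφ.id_le k).trans (Nat.le_add_right _ M)) tendsto_id
    rwa [tendsto_nhds_unique (hl.comp hsub) hgap] at hl
  refine tendsto_of_subseq_tendsto fun ns hns => ?_
  obtain ⟨y, -, ms, hms, hy⟩ := tendsto_subseq_of_bounded hbdd (x := fun k => X (ns k))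
    fun k => mem_range_self _
  refine ⟨ms, ?_⟩
  -- The last Bregman axiom, applied to the constant sequence `xopt`, identifies every cluster point
  -- with `xopt`.
  have hc : Tendsto (fun _ : ℕ => xopt) atTop (𝓝 y) :=
    hf.tendsto_of_bregmanDist (fun _ => xopt) (fun k => X (ns (ms k))) y (fun _ => hxf.1)
      (fun k => h.mem hf _) (hdist.comp (hns.comp hms.tendsto_atTop)) hy
      (by rw [range_const]; exact Bornology.isBounded_singleton)
  rwa [tendsto_nhds_unique hc tendsto_const_nhds] at hy

end IsProjectChain

end ProjectForget

/-! ### Second-order expansion and a local error bound. -/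

namespace ProjectForget

variable {d : ℕ} {f : EuclideanSpace ℝ (Fin d) → ℝ} {S : Set (EuclideanSpace ℝ (Fin d))}
  {ι : Type*} {a : ι → EuclideanSpace ℝ (Fin d)} {b : ι → ℝ} {x : EuclideanSpace ℝ (Fin d)}

lemma TwiceDifferentiableAt.symmetric (h : TwiceDifferentiableAt f x)
    (v w : EuclideanSpace ℝ (Fin d)) :
    fderiv ℝ (fderiv ℝ f) x v w = fderiv ℝ (fderiv ℝ f) x w v :=
  second_derivative_symmetric_of_eventually (h.1.mono fun _ hy => hy.hasFDerivAt)
    h.2.hasFDerivAt v w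

lemma TwiceDifferentiableAt.eventually_norm_fderiv_sub_le (h : TwiceDifferentiableAt f x)
    {ε : ℝ} (hε : 0 < ε) :
    ∀ᶠ y in 𝓝 x, ‖fderiv ℝ f y - fderiv ℝ f x - fderiv ℝ (fderiv ℝ f) x (y - x)‖ ≤
      ε * ‖y - x‖ :=
  h.2.hasFDerivAt.isLittleO.def hε

/-- The Bregman distance is half the squared Hessian norm up to second order terms. -/
lemma TwiceDifferentiableAt.exists_abs_bregmanDist_sub_le (h : TwiceDifferentiableAt f x)
    {ε : ℝ} (hε : 0 < ε) :
    ∃ δ > 0, ∀ y ∈ Metric.ball x δ, ∀ y' ∈ Metric.ball x δ,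
      |bregmanDist f y' y - hessianForm f x (y' - y) / 2| ≤
        ε * (‖y - x‖ ^ 2 + ‖y' - x‖ ^ 2) := by
  -- The mean value inequality is applied to `f` minus its quadratic part. With `ε / 4` here, its
  -- derivative oscillates by at most `ε / 2 * r` on the ball of radius `r`, and `‖y' - y‖ ≤ 2 * r`.
  obtain ⟨δ, hδ, hball⟩ := Metric.eventually_nhds_iff_ball.1
    (h.1.and (h.eventually_norm_fderiv_sub_le (show 0 < ε / 4 by positivity)))
  refine ⟨δ, hδ, fun y hy y' hy' => ?_⟩
  set B := fderiv ℝ (fderiv ℝ f) x with hB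
  set r := max ‖y - x‖ ‖y' - x‖ with hr
  have hrδ : r < δ := max_lt (by simpa [dist_eq_norm] using hy) (by simpa [dist_eq_norm] using hy')
  have hsub : Metric.closedBall x r ⊆ Metric.ball x δ := Metric.closedBall_subset_ball hrδ
  have hyr : y ∈ Metric.closedBall x r := by
    rw [mem_closedBall_iff_norm]; exact le_max_left _ _
  have hyr' : y' ∈ Metric.closedBall x r := by
    rw [mem_closedBall_iff_norm]; exact le_max_right _ _
  have hder : ∀ w ∈ Metric.closedBall x r,
      HasFDerivWithinAt (fun w => f w - B (w - x) (w - x) / 2) (fderiv ℝ f w - B (w - x))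
        (Metric.closedBall x r) w := by
    intro w hw
    have h1 : HasFDerivAt (fun w => w - x) (ContinuousLinearMap.id ℝ _) w :=
      (hasFDerivAt_id w).sub_const x
    have h2 := (B.hasFDerivAt.comp w h1).clm_apply h1
    have h3 := (hball w (hsub hw)).1.hasFDerivAt.sub (h2.const_mul (1 / 2))
    refine (h3.congr_fderiv ?_).hasFDerivWithinAt.congr (fun v _ => ?_) ?_
    · ext v
      simp only [_root_.sub_apply, _root_.add_apply,
        _root_.smul_apply, ContinuousLinearMap.comp_apply,
        ContinuousLinearMap.flip_apply, ContinuousLinearMap.id_apply, smul_eq_mul,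
        Function.comp_apply]
      rw [h.symmetric v (w - x)]
      ring
    · simp only [Function.comp_apply, Pi.sub_apply]; ring
    · simp only [Function.comp_apply, Pi.sub_apply]; ring
  have hnear : ∀ w ∈ Metric.closedBall x r,
      ‖fderiv ℝ f w - B (w - x) - fderiv ℝ f x‖ ≤ ε / 4 * r := by
    intro w hw
    rw [sub_right_comm]
    refine ((hball w (hsub hw)).2).trans ?_
    gcongr
    exact mem_closedBall_iff_norm.1 hw
  have hbound : ∀ w ∈ Metric.closedBall x r,
      ‖(fderiv ℝ f w - B (w - x)) - (fderiv ℝ f y - B (y - x))‖ ≤ ε / 2 * r := by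
    intro w hw
    have := norm_sub_le_norm_sub_add_norm_sub (fderiv ℝ f w - B (w - x)) (fderiv ℝ f x)
      (fderiv ℝ f y - B (y - x))
    rw [norm_sub_rev (fderiv ℝ f x)] at this
    linarith [hnear w hw, hnear y hyr]
  have hmv := (convex_closedBall x r).norm_image_sub_le_of_norm_hasFDerivWithin_le' hder hbound
    hyr hyr'
  have heq : f y' - B (y' - x) (y' - x) / 2 - (f y - B (y - x) (y - x) / 2) -
      (fderiv ℝ f y - B (y - x)) (y' - y) =
      bregmanDist f y' y - hessianForm f x (y' - y) / 2 := by
    have h1 : y' - y = (y' - x) - (y - x) := by abel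
    rw [bregmanDist_eq_fderiv, hessianForm, ← hB]
    simp only [_root_.sub_apply]
    rw [h1]
    simp only [map_sub, _root_.sub_apply]
    have hs := h.symmetric
    simp only [← hB] at hs
    rw [hs y' y, hs y' x, hs x y]
    ring
  rw [heq, Real.norm_eq_abs] at hmv
  have hyy : ‖y' - y‖ ≤ 2 * r := by
    have := norm_sub_le_norm_sub_add_norm_sub y' x y
    rw [norm_sub_rev x y] at this
    linarith [le_max_left ‖y - x‖ ‖y' - x‖, le_max_right ‖y - x‖ ‖y' - x‖]
  have hr2 : r ^ 2 ≤ ‖y - x‖ ^ 2 + ‖y' - x‖ ^ 2 := by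
    rcases max_choice ‖y - x‖ ‖y' - x‖ with h' | h' <;> rw [hr, h'] <;>
      linarith [sq_nonneg ‖y - x‖, sq_nonneg ‖y' - x‖]
  have hr0 : 0 ≤ r := (norm_nonneg _).trans (le_max_left _ _)
  calc _ ≤ ε / 2 * r * ‖y' - y‖ := hmv
    _ ≤ ε / 2 * r * (2 * r) := by gcongr
    _ = ε * r ^ 2 := by ring
    _ ≤ _ := by gcongr

lemma exists_mul_norm_sq_le_hessianForm (hpos : ∀ v, v ≠ 0 → 0 < hessianForm f x v) :
    ∃ c > 0, ∀ v, c * ‖v‖ ^ 2 ≤ hessianForm f x v := by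
  have hcont : Continuous (hessianForm f x) :=
    (fderiv ℝ (fderiv ℝ f) x).continuous.clm_apply continuous_id
  by_cases hne : (Metric.sphere (0 : EuclideanSpace ℝ (Fin d)) 1).Nonempty
  · obtain ⟨w, hw, hmin⟩ := (isCompact_sphere (0 : EuclideanSpace ℝ (Fin d)) 1).exists_isMinOn hne
      hcont.continuousOn
    refine ⟨hessianForm f x w, hpos w (ne_zero_of_mem_unit_sphere ⟨w, hw⟩), fun v => ?_⟩
    by_cases hv : v = 0
    · simp [hv, hessianForm]
    · have hv' : 0 < ‖v‖ := norm_pos_iff.2 hv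
      have h1 : hessianForm f x w ≤ hessianForm f x (‖v‖⁻¹ • v) :=
        hmin (by simp [norm_smul, hv'.ne'])
      have h2 : hessianForm f x (‖v‖⁻¹ • v) = hessianForm f x v / ‖v‖ ^ 2 := by
        simp only [hessianForm, map_smul, _root_.smul_apply, smul_eq_mul]
        field_simp
      rwa [h2, le_div_iff₀ (by positivity)] at h1
  -- An empty unit sphere means that the space is trivial.
  · refine ⟨1, one_pos, fun v => ?_⟩
    have hv : v = 0 := by
      by_contra hv
      exact hne ⟨‖v‖⁻¹ • v, by simp [norm_smul, norm_ne_zero_iff.2 hv]⟩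
    simp [hv, hessianForm]

lemma hessianForm_le (f : EuclideanSpace ℝ (Fin d) → ℝ) (x v : EuclideanSpace ℝ (Fin d)) :
    hessianForm f x v ≤ ‖fderiv ℝ (fderiv ℝ f) x‖ * ‖v‖ ^ 2 := by
  refine (le_abs_self _).trans ?_
  rw [sq, ← mul_assoc]
  exact (fderiv ℝ (fderiv ℝ f) x).le_opNorm₂ v v

/-- Only the projection of `u` to the span matters, and there the residual map `u ↦ (⟨a i, u⟩)` is
injective: its kernel is orthogonal to the span. In finite dimension it is bounded below. -/
lemma exists_inner_le_of_mem_span {E : Type*} [NormedAddCommGroup E] [InnerProductSpace ℝ E]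
    [FiniteDimensional ℝ E] (a : ι → E) (P : Finset ι) :
    ∃ C ≥ 0, ∀ g ∈ Submodule.span ℝ (a '' P), ∀ u,
      inner ℝ g u ≤ C * ‖g‖ * ∑ i ∈ P, |inner ℝ (a i) u| := by
  set V := Submodule.span ℝ (a '' (P : Set ι)) with hV
  have ha : ∀ i ∈ P, a i ∈ V := fun i hi => Submodule.subset_span ⟨i, hi, rfl⟩
  let T : V →ₗ[ℝ] (P → ℝ) := LinearMap.pi fun i => (innerSL ℝ (a i)).toLinearMap ∘ₗ V.subtype
  have hker : LinearMap.ker T = ⊥ := by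
    rw [LinearMap.ker_eq_bot']
    intro v hv
    have hvV : V ≤ (Submodule.span ℝ {(v : E)})ᗮ := by
      refine Submodule.span_le.2 ?_
      rintro _ ⟨i, hi, rfl⟩
      rw [SetLike.mem_coe, Submodule.mem_orthogonal_singleton_iff_inner_left]
      exact congrFun hv ⟨i, hi⟩
    have := (Submodule.mem_orthogonal_singleton_iff_inner_left).1 (hvV v.2)
    exact Subtype.ext (inner_self_eq_zero.1 this)
  obtain ⟨K, -, hK⟩ := T.exists_antilipschitzWith hker
  refine ⟨K, K.2, fun g hg u => ?_⟩
  have hinner : ∀ w ∈ V, inner ℝ w ((V.orthogonalProjectionOnto u : V) : E) = inner ℝ w u :=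
    fun w hw =>
    Submodule.inner_orthogonalProjectionOnto_eq_of_mem_left ⟨w, hw⟩ u
  have hT : ‖T (V.orthogonalProjectionOnto u)‖ ≤ ∑ i ∈ P, |inner ℝ (a i) u| := by
    rw [pi_norm_le_iff_of_nonneg (Finset.sum_nonneg fun _ _ => abs_nonneg _)]
    intro i
    have : T (V.orthogonalProjectionOnto u) i = inner ℝ (a i) u := hinner _ (ha i i.2)
    rw [this, Real.norm_eq_abs]
    exact Finset.single_le_sum (f := fun i => |inner ℝ (a i) u|) (fun _ _ => abs_nonneg _) i.2
  have hn : ‖V.orthogonalProjectionOnto u‖ ≤ K * ‖T (V.orthogonalProjectionOnto u)‖ := by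
    simpa using hK.le_mul_dist (V.orthogonalProjectionOnto u) 0
  rw [← hinner g hg]
  calc _ ≤ ‖g‖ * ‖((V.orthogonalProjectionOnto u : V) : E)‖ := real_inner_le_norm _ _
    _ ≤ ‖g‖ * (K * ∑ i ∈ P, |inner ℝ (a i) u|) := by
        gcongr
        exact hn.trans (by gcongr)
    _ = _ := by ring

lemma gradient_sub_norm (f : EuclideanSpace ℝ (Fin d) → ℝ) (x y : EuclideanSpace ℝ (Fin d)) :
    ‖gradient f y - gradient f x‖ = ‖fderiv ℝ f y - fderiv ℝ f x‖ := by
  rw [gradient, gradient, ← map_sub, LinearIsometryEquiv.norm_map]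

/-- Near `x`, the distance to `x` is controlled by the residuals of the constraints that span the
gradient. -/
lemma TwiceDifferentiableAt.exists_norm_sub_le [Fintype ι] (h : TwiceDifferentiableAt f x)
    (hpos : ∀ v, v ≠ 0 → 0 < hessianForm f x v) (a : ι → EuclideanSpace ℝ (Fin d)) :
    ∃ C > 0, ∀ᶠ y in 𝓝 x, ∀ P : Finset ι, gradient f y ∈ Submodule.span ℝ (a '' P) →
      ‖y - x‖ ≤ C * ∑ i ∈ P, |inner ℝ (a i) (y - x)| := by
  obtain ⟨c, hc, hcB⟩ := exists_mul_norm_sq_le_hessianForm hpos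
  choose C hC0 hC using exists_inner_le_of_mem_span a
  set C₁ := ∑ P, C P with hC₁
  have hCP : ∀ P, C P ≤ C₁ := fun P =>
    Finset.single_le_sum (fun P _ => hC0 P) (Finset.mem_univ P)
  have hC₁0 : 0 ≤ C₁ := Finset.sum_nonneg fun P _ => hC0 P
  set K := ‖fderiv ℝ (fderiv ℝ f) x‖ + c / 2 with hK
  have hK0 : 0 < K := by positivity
  refine ⟨2 * C₁ * K / c + 1, by positivity, ?_⟩
  have hcont : ContinuousAt (gradient f) x := by
    have := h.2.continuousAt
    exact (InnerProductSpace.toDual ℝ _).symm.continuous.continuousAt.comp this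
  -- Spans are closed and finite in number, so near `x` a span containing the gradient at `y` also
  -- contains the gradient at `x`, hence their difference.
  have hmem : ∀ᶠ y in 𝓝 x, ∀ P : Finset ι, gradient f y ∈ Submodule.span ℝ (a '' P) →
      gradient f x ∈ Submodule.span ℝ (a '' P) := by
    refine Filter.eventually_all.2 fun P => ?_
    by_cases hP : gradient f x ∈ Submodule.span ℝ (a '' (P : Set ι))
    · exact Eventually.of_forall fun _ _ => hP
    · filter_upwards [hcont.eventually_mem
        ((Submodule.span ℝ (a '' (P : Set ι))).closed_of_finiteDimensional.isOpen_compl.mem_nhds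
          hP)] with y hy hy'
      exact absurd hy' hy
  filter_upwards [hmem, h.eventually_norm_fderiv_sub_le (half_pos hc)] with y hy hlin P hP
  set u := y - x with hu
  have hG := Submodule.sub_mem _ hP (hy P hP)
  have h1 := hC P _ hG u
  -- Strong monotonicity of the gradient near `x`. Against the upper bound `C₁ * (K * ‖u‖) * s`, one
  -- factor `‖u‖` cancels.
  have h2 : c / 2 * ‖u‖ ^ 2 ≤ inner ℝ (gradient f y - gradient f x) u := by
    rw [inner_sub_left, inner_gradient_eq_fderiv, inner_gradient_eq_fderiv]
    have h3 := (fderiv ℝ f y - fderiv ℝ f x - fderiv ℝ (fderiv ℝ f) x u).le_of_opNorm_le hlin u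
    rw [Real.norm_eq_abs] at h3
    simp only [_root_.sub_apply] at h3
    have h4 := hcB u
    rw [hessianForm] at h4
    linarith [neg_abs_le (fderiv ℝ f y u - fderiv ℝ f x u - fderiv ℝ (fderiv ℝ f) x u u)]
  have h3 : ‖gradient f y - gradient f x‖ ≤ K * ‖u‖ := by
    rw [gradient_sub_norm]
    have h4 := norm_le_norm_sub_add (fderiv ℝ f y - fderiv ℝ f x) (fderiv ℝ (fderiv ℝ f) x u)
    have h5 := (fderiv ℝ (fderiv ℝ f) x).le_opNorm u
    rw [hK]
    linarith
  set s := ∑ i ∈ P, |inner ℝ (a i) u| with hs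
  have hs0 : 0 ≤ s := Finset.sum_nonneg fun _ _ => abs_nonneg _
  have h4 : c / 2 * ‖u‖ ^ 2 ≤ C₁ * (K * ‖u‖) * s := by
    refine h2.trans (h1.trans ?_)
    gcongr
    exact hCP P
  rcases (norm_nonneg u).eq_or_lt with h0 | h0
  · rw [← h0]; positivity
  · have h5 : c / 2 * ‖u‖ ≤ C₁ * K * s := by
      refine le_of_mul_le_mul_right ?_ h0
      linarith
    have h6 : ‖u‖ ≤ 2 * C₁ * K / c * s := by
      rw [div_mul_eq_mul_div, le_div_iff₀ hc]
      linarith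
    linarith

end ProjectForget

/-! ### Local contraction over a covering window. -/

namespace ProjectForget

variable {d : ℕ} {f : EuclideanSpace ℝ (Fin d) → ℝ} {S : Set (EuclideanSpace ℝ (Fin d))}
  {ι : Type*} {a : ι → EuclideanSpace ℝ (Fin d)} {b : ι → ℝ}

/-- Passage from the decrease of a Lyapunov function comparable with `q₀ / 2`, `q₁ / 2` to the
decrease from `q₀` to `q₁`. -/
lemma le_mul_of_perturbed_decrease {κ t q₀ q₁ D₀ D₁ : ℝ} (hκ : 0 < κ) (ht : 0 < t)
    (ht1 : 10 * t ≤ 1) (htκ : 10 * t ≤ κ) (hq₀ : 0 ≤ q₀) (hq₁ : 0 ≤ q₁)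
    (hD : (1 + κ) * D₁ ≤ (1 + t) * D₀) (h₁ : (1 - t) * q₁ ≤ 2 * D₁)
    (h₀ : 2 * D₀ ≤ (1 + t) * q₀) : q₁ ≤ (1 + 3 * t) / (1 + 8 * t) * q₀ := by
  rw [div_mul_eq_mul_div, le_div_iff₀ (by positivity)]
  have e1 : (1 + κ) * ((1 - t) * q₁) ≤ (1 + t) * ((1 + t) * q₀) := by
    have := mul_le_mul_of_nonneg_left h₁ (show 0 ≤ 1 + κ by linarith)
    have := mul_le_mul_of_nonneg_left h₀ (show 0 ≤ 1 + t by linarith)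
    linarith
  have e2 : (1 + 8 * t) * q₁ ≤ (1 + κ) * ((1 - t) * q₁) := by
    rw [← mul_assoc]
    refine mul_le_mul_of_nonneg_right ?_ hq₁
    nlinarith
  have e3 : (1 + t) * ((1 + t) * q₀) ≤ (1 + 3 * t) * q₀ := by
    rw [← mul_assoc]
    refine mul_le_mul_of_nonneg_right ?_ hq₀
    nlinarith
  linarith

lemma norm_sub_le_sum_norm_sub {E : Type*} [SeminormedAddCommGroup E] (Y : ℕ → E) {j M : ℕ}
    (hj : j ≤ M) : ‖Y M - Y j‖ ≤ ∑ k ∈ Finset.range M, ‖Y (k + 1) - Y k‖ := by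
  rw [← dist_eq_norm, dist_comm]
  refine (dist_le_Ico_sum_dist Y hj).trans ?_
  simp only [dist_comm (Y _) (Y (_ + 1)), dist_eq_norm]
  refine Finset.sum_le_sum_of_subset_of_nonneg ?_ fun _ _ _ => norm_nonneg _
  rw [Finset.range_eq_Ico]
  exact Finset.Ico_subset_Ico_left (Nat.zero_le j)

namespace IsProjectChain

variable [DecidableEq ι] {I : ℕ → Option ι} {X : ℕ → EuclideanSpace ℝ (Fin d)}
  {Z : ℕ → ι → ℝ}

/-- Once the iterates stay strictly inside the half-space, the constraint is never tight again: each
processing leaves its multiplier zero, and between processings it does not change. -/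
lemma eventually_dual_eq_zero (hf : IsBregmanFunction f S) (h : IsProjectChain f S a b I X Z)
    {M : ℕ} (hM : ∃ᶠ n in atTop, CoversAll I M n) {x : EuclideanSpace ℝ (Fin d)}
    (hx : Tendsto X atTop (𝓝 x)) {i : ι} (hi : inner ℝ (a i) x < b i) :
    ∀ᶠ n in atTop, Z n i = 0 := by
  have hlt : ∀ᶠ n in atTop, inner ℝ (a i) (X n) < b i :=
    (((innerSL ℝ (a i)).continuous.tendsto x).comp hx).eventually (gt_mem_nhds hi)
  obtain ⟨n₀, hn₀⟩ := eventually_atTop.1 hlt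
  obtain ⟨n₁, hn₁, hcov⟩ := frequently_atTop.1 hM n₀
  refine eventually_atTop.2 ⟨n₁ + M, fun n hn => ?_⟩
  induction n, hn using Nat.le_induction with
  | base =>
    obtain ⟨j, -, hj⟩ := h.exists_active_or_dual_eq_zero hf (hcov i)
    have := hn₀ (n₁ + j) (by omega)
    rcases hj with hj | hj
    · linarith
    · exact hj.2
  | succ n hn ih =>
    by_cases hI : I n = some i
    · obtain ⟨j, -, hj⟩ :=
        h.exists_active_or_dual_eq_zero hf (n := n) (m := 1) ⟨0, one_pos, hI⟩
      have := hn₀ (n + j) (by omega)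
      rcases hj with hj | hj
      · linarith
      · exact hj.2
    · rw [h.dual_succ_of_ne hf hI, ih]

lemma eventually_dualityGap_eq [Fintype ι] (hf : IsBregmanFunction f S)
    (h : IsProjectChain f S a b I X Z) {M : ℕ} (hM : ∃ᶠ n in atTop, CoversAll I M n)
    {x : EuclideanSpace ℝ (Fin d)} (hxf : x ∈ feasibleSet S a b) (hx : Tendsto X atTop (𝓝 x)) :
    ∀ᶠ n in atTop, dualityGap f a b x (X n) (Z n) = bregmanDist f x (X n) := by
  have : ∀ i, ∀ᶠ n in atTop, Z n i * (b i - inner ℝ (a i) x) = 0 := by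
    intro i
    rcases (hxf.2 i).eq_or_lt with heq | hlt
    · simp [heq]
    · filter_upwards [h.eventually_dual_eq_zero hf hM hx hlt] with n hn
      simp [hn]
  filter_upwards [Filter.eventually_all.2 this] with n hn
  simp [dualityGap, hn]

/-- After all the constraints have been processed, the distance to the limit is controlled by the
length of the path. -/
lemma exists_eventually_norm_sub_le_sum [Fintype ι] (hf : IsBregmanFunction f S)
    {x : EuclideanSpace ℝ (Fin d)} (hxf : x ∈ feasibleSet S a b)
    (htw : TwiceDifferentiableAt f x) (hpos : ∀ v, v ≠ 0 → 0 < hessianForm f x v) (M : ℕ) :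
    ∃ C > 0, ∀ (I : ℕ → Option ι) (X : ℕ → EuclideanSpace ℝ (Fin d)) (Z : ℕ → ι → ℝ),
      IsProjectChain f S a b I X Z → (∃ᶠ n in atTop, CoversAll I M n) →
      Tendsto X atTop (𝓝 x) → ∀ᶠ n in atTop, CoversAll I M n →
        ‖X (n + M) - x‖ ≤
          C * ∑ k ∈ Finset.range M, ‖X (n + (k + 1)) - X (n + k)‖ := by
  obtain ⟨C, hC, hev⟩ := htw.exists_norm_sub_le hpos a
  have hA : 0 ≤ ∑ i, ‖a i‖ := Finset.sum_nonneg fun _ _ => norm_nonneg _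
  refine ⟨C * (∑ i, ‖a i‖) + 1, by positivity, fun I X Z h hM hx => ?_⟩
  have hinact : ∀ i, ∀ᶠ n in atTop, inner ℝ (a i) x < b i → Z n i = 0 := fun i => by
    by_cases hi : inner ℝ (a i) x < b i
    · exact (h.eventually_dual_eq_zero hf hM hx hi).mono fun _ hn _ => hn
    · exact Eventually.of_forall fun _ hi' => absurd hi' hi
  have hshift : Tendsto (fun n => n + M) atTop atTop := tendsto_add_atTop_nat M
  filter_upwards [(hx.comp hshift).eventually hev,
    hshift.eventually (Filter.eventually_all.2 hinact)] with n hn hin hcov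
  set s := ∑ k ∈ Finset.range M, ‖X (n + (k + 1)) - X (n + k)‖ with hs
  have hs0 : 0 ≤ s := Finset.sum_nonneg fun _ _ => norm_nonneg _
  set P : Finset ι := {i | Z (n + M) i ≠ 0} with hP
  have hgrad : gradient f (X (n + M)) ∈ Submodule.span ℝ (a '' P) := by
    rw [h.gradient_eq hf]
    refine Submodule.neg_mem _ (Submodule.sum_mem _ fun i _ => ?_)
    by_cases hi : Z (n + M) i = 0
    · simp [hi]
    · exact Submodule.smul_mem _ _ (Submodule.subset_span ⟨i, by simpa [hP] using hi, rfl⟩)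
  have hres : ∀ i ∈ P, |inner ℝ (a i) (X (n + M) - x)| ≤ ‖a i‖ * s := by
    intro i hi
    have hZ : Z (n + M) i ≠ 0 := by simpa [hP] using hi
    -- A nonzero multiplier forces tightness at `x` and at some time of the window, so the residual
    -- is a displacement within the window.
    have hbx : inner ℝ (a i) x = b i :=
      (hxf.2 i).eq_or_lt.resolve_right fun hlt => hZ (hin i hlt)
    obtain ⟨j, hj, hjb | hj0⟩ := h.exists_active_or_dual_eq_zero hf (hcov i)
    · have : inner ℝ (a i) (X (n + M) - x) = inner ℝ (a i) (X (n + M) - X (n + j)) := by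
        rw [inner_sub_right, inner_sub_right, hbx, hjb]
      rw [this]
      refine (abs_real_inner_le_norm _ _).trans ?_
      gcongr
      exact norm_sub_le_sum_norm_sub (fun k => X (n + k)) hj
    · exact absurd hj0.2 hZ
  calc ‖X (n + M) - x‖ ≤ C * ∑ i ∈ P, |inner ℝ (a i) (X (n + M) - x)| := hn P hgrad
    _ ≤ C * ∑ i ∈ P, ‖a i‖ * s := by gcongr with i hi; exact hres i hi
    _ ≤ C * ∑ i, ‖a i‖ * s := by
        gcongr
        exact Finset.subset_univ P
    _ = C * (∑ i, ‖a i‖) * s := by rw [← Finset.sum_mul, mul_assoc]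
    _ ≤ _ := by linarith

/-- A block in which all the constraints are processed contracts the squared Hessian norm. -/
lemma exists_eventually_hessianForm_le [Fintype ι] (hf : IsBregmanFunction f S)
    {x : EuclideanSpace ℝ (Fin d)} (hxf : x ∈ feasibleSet S a b)
    (htw : TwiceDifferentiableAt f x) (hpos : ∀ v, v ≠ 0 → 0 < hessianForm f x v) (M : ℕ) :
    ∃ r, 0 < r ∧ r < 1 ∧
      ∀ (I : ℕ → Option ι) (X : ℕ → EuclideanSpace ℝ (Fin d)) (Z : ℕ → ι → ℝ),
      IsProjectChain f S a b I X Z → (∃ᶠ n in atTop, CoversAll I M n) →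
      Tendsto X atTop (𝓝 x) → ∀ᶠ n in atTop, CoversAll I M n →
        hessianForm f x (X (n + M) - x) ≤ r * hessianForm f x (X n - x) := by
  obtain ⟨C, hC, hpath⟩ := exists_eventually_norm_sub_le_sum hf hxf htw hpos M
  obtain ⟨c, hc, hcB⟩ := exists_mul_norm_sq_le_hessianForm hpos
  set K := ‖fderiv ℝ (fderiv ℝ f) x‖ + c with hK
  have hKB : ∀ v, hessianForm f x v ≤ K * ‖v‖ ^ 2 := fun v =>
    (hessianForm_le f x v).trans (by gcongr; linarith)
  have hcK : c ≤ K := by rw [hK]; linarith [norm_nonneg (fderiv ℝ (fderiv ℝ f) x)]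
  have hK0 : 0 < K := hc.trans_le hcK
  have hM0 : (0 : ℝ) < M + 1 := by positivity
  -- Chosen so that the path-length bound gives `κ * D M ≤ c / 2 * T`, with `T` the sum of squared
  -- step lengths.
  set κ := c / (2 * K * C ^ 2 * (M + 1)) with hκdef
  have hκ : 0 < κ := by positivity
  set t := min κ 1 / 10 with htdef
  have ht : 0 < t := by positivity
  have ht1 : 10 * t ≤ 1 := by rw [htdef]; linarith [min_le_right κ 1]
  have htκ : 10 * t ≤ κ := by rw [htdef]; linarith [min_le_left κ 1]
  -- Keeps the Taylor errors of all `M` steps together below `t * D 0`.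
  set ε := c * t / (8 * (M + 1)) with hεdef
  have hε : 0 < ε := by positivity
  have hεM : 8 * (M + 1) * ε = c * t := by rw [hεdef]; field_simp
  have hMr : (0 : ℝ) ≤ M := Nat.cast_nonneg M
  have hε8 : 8 * ε ≤ c * t := by rw [← hεM]; nlinarith
  have hε4 : 4 * ε ≤ c := by nlinarith
  clear_value ε
  refine ⟨(1 + 3 * t) / (1 + 8 * t), by positivity,
    (div_lt_one (by positivity)).2 (by linarith), fun I X Z h hM hx => ?_⟩
  obtain ⟨δ, hδ, htaylor⟩ := htw.exists_abs_bregmanDist_sub_le hε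
  have hball : ∀ᶠ n in atTop, X n ∈ Metric.ball x δ := hx.eventually (Metric.ball_mem_nhds x hδ)
  filter_upwards [hpath I X Z h hM hx, eventually_forall_ge_atTop.2 hball,
    eventually_forall_ge_atTop.2 (h.eventually_dualityGap_eq hf hM hxf hx)] with n hn hb hg hcov
  have hD : ∀ j, bregmanDist f x (X (n + j)) = dualityGap f a b x (X (n + j)) (Z (n + j)) :=
    fun j => (hg _ (Nat.le_add_right n j)).symm
  have hanti := h.antitone_dualityGap hf x
  set D := fun j => bregmanDist f x (X (n + j)) with hDdef
  have hDanti : ∀ j, D j ≤ D 0 := fun j => by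
    simp only [hDdef, hD]
    exact hanti (by omega)
  have hcomp : ∀ j, |D j - hessianForm f x (X (n + j) - x) / 2| ≤ ε * ‖X (n + j) - x‖ ^ 2 := by
    intro j
    have h1 := htaylor _ (hb _ (Nat.le_add_right n j)) x (Metric.mem_ball_self hδ)
    have h2 : hessianForm f x (x - X (n + j)) = hessianForm f x (X (n + j) - x) := by
      rw [← neg_sub, hessianForm, hessianForm, map_neg, map_neg, neg_apply, neg_neg]
    simpa [h2] using h1
  have hnorm : ∀ j, c * ‖X (n + j) - x‖ ^ 2 ≤ 4 * D 0 := by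
    intro j
    have h1 := abs_le.1 (hcomp j)
    have h2 := mul_le_mul_of_nonneg_right hε4 (sq_nonneg ‖X (n + j) - x‖)
    linarith [hcB (X (n + j) - x), hDanti j]
  have hstep : ∀ k, c / 2 * ‖X (n + (k + 1)) - X (n + k)‖ ^ 2 - 8 * ε / c * D 0 ≤
      D k - D (k + 1) := by
    intro k
    have h1 := h.bregmanDist_le_dualityGap_sub hf x (n + k)
    have h2 := abs_le.1 (htaylor _ (hb _ (Nat.le_add_right n k)) _
      (hb _ (Nat.le_add_right n (k + 1))))
    have h3 : ε * (‖X (n + k) - x‖ ^ 2 + ‖X (n + (k + 1)) - x‖ ^ 2) ≤ 8 * ε / c * D 0 := by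
      rw [div_mul_eq_mul_div, le_div_iff₀ hc]
      have := mul_le_mul_of_nonneg_left (add_le_add (hnorm k) (hnorm (k + 1))) hε.le
      linarith
    rw [add_assoc, ← hD, ← hD] at h1
    change bregmanDist f (X (n + (k + 1))) (X (n + k)) ≤ D k - D (k + 1) at h1
    linarith [hcB (X (n + (k + 1)) - X (n + k))]
  set T := ∑ k ∈ Finset.range M, ‖X (n + (k + 1)) - X (n + k)‖ ^ 2 with hT
  have hT0 : 0 ≤ T := Finset.sum_nonneg fun _ _ => sq_nonneg _
  have hD00 : 0 ≤ D 0 := by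
    have := hnorm 0
    have : 0 ≤ c * ‖X (n + 0) - x‖ ^ 2 := by positivity
    linarith
  have htele : c / 2 * T - M * (8 * ε / c * D 0) ≤ D 0 - D M := by
    rw [← Finset.sum_range_sub', hT, Finset.mul_sum]
    have := Finset.sum_le_sum fun k (_ : k ∈ Finset.range M) => hstep k
    simpa [Finset.sum_sub_distrib] using this
  have hMt : M * (8 * ε / c * D 0) ≤ t * D 0 := by
    rw [← mul_assoc]
    refine mul_le_mul_of_nonneg_right ?_ hD00
    rw [mul_div_assoc', div_le_iff₀ hc]
    linarith
  have hDM : D M ≤ K * ‖X (n + M) - x‖ ^ 2 := by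
    have h1 := abs_le.1 (hcomp M)
    have h2 := mul_le_mul_of_nonneg_right (show 4 * ε ≤ K by linarith)
      (sq_nonneg ‖X (n + M) - x‖)
    linarith [hKB (X (n + M) - x), mul_nonneg hK0.le (sq_nonneg ‖X (n + M) - x‖)]
  have huM : ‖X (n + M) - x‖ ^ 2 ≤ C ^ 2 * ((M + 1) * T) := by
    have h1 := pow_le_pow_left₀ (norm_nonneg _) (hn hcov) 2
    have h2 := sq_sum_le_card_mul_sum_sq (s := Finset.range M)
      (f := fun k => ‖X (n + (k + 1)) - X (n + k)‖)
    rw [Finset.card_range] at h2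
    rw [mul_pow] at h1
    refine h1.trans ?_
    gcongr
    linarith
  have hκD : κ * D M ≤ c / 2 * T := by
    calc κ * D M ≤ κ * (K * (C ^ 2 * ((M + 1) * T))) := by
          gcongr
          exact hDM.trans (by gcongr)
      _ = c / 2 * T := by rw [hκdef]; field_simp
  have hquad : ∀ j, 2 * ε * ‖X (n + j) - x‖ ^ 2 ≤ t * hessianForm f x (X (n + j) - x) := fun j =>
    calc 2 * ε * ‖X (n + j) - x‖ ^ 2 ≤ c * t * ‖X (n + j) - x‖ ^ 2 := by
          exact mul_le_mul_of_nonneg_right (by linarith) (sq_nonneg _)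
      _ = t * (c * ‖X (n + j) - x‖ ^ 2) := by ring
      _ ≤ _ := by gcongr; exact hcB _
  have hq0 : ∀ v, 0 ≤ hessianForm f x v := fun v => (by positivity : 0 ≤ c * ‖v‖ ^ 2).trans (hcB v)
  -- Telescoping gives `c / 2 * T ≤ D 0 - D M + t * D 0`; with `hκD` this is `(1 + κ) * D M ≤ (1 +
  -- t) * D 0`.
  refine le_mul_of_perturbed_decrease hκ ht ht1 htκ (hq0 _) (hq0 _) (D₀ := D 0) (D₁ := D M)
    (by linarith) ?_ ?_
  · linarith [(abs_le.1 (hcomp M)).1, hquad M]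
  · have h1 := (abs_le.1 (hcomp 0)).2
    have h2 := hquad 0
    rw [add_zero] at h1 h2
    linarith

end IsProjectChain

end ProjectForget

/-! ### Recurrence of patterns under conditional lower bounds. -/

namespace ProjectForget

section Sampling

variable {Ω α : Type*} {L : ℕ → Ω → α}

/-- The event `B` is determined by the values of `L 0, …, L (ν - 1)`. -/
def DependsOnPast (L : ℕ → Ω → α) (ν : ℕ) (B : Set Ω) : Prop :=
  ∀ ω ω', (∀ k < ν, L k ω = L k ω') → ω ∈ B → ω' ∈ B

namespace DependsOnPast

variable {B B' : Set Ω} {ν ν' : ℕ}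

lemma mono (h : DependsOnPast L ν B) (hν : ν ≤ ν') : DependsOnPast L ν' B :=
  fun ω ω' hω => h ω ω' fun k hk => hω k (hk.trans_le hν)

lemma inter (h : DependsOnPast L ν B) (h' : DependsOnPast L ν B') :
    DependsOnPast L ν (B ∩ B') :=
  fun ω ω' hω hB => ⟨h ω ω' hω hB.1, h' ω ω' hω hB.2⟩

lemma compl (h : DependsOnPast L ν B) : DependsOnPast L ν Bᶜ :=
  fun ω ω' hω hB hB' => hB (h ω' ω (fun k hk => (hω k hk).symm) hB')

lemma of_value (A : Set α) {k : ℕ} (hk : k < ν) : DependsOnPast L ν {ω | L k ω ∈ A} :=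
  fun ω ω' hω (hA : L k ω ∈ A) => show L k ω' ∈ A from hω k hk ▸ hA

lemma forall_value (A : ℕ → Set α) (n N : ℕ) :
    DependsOnPast L (n + N) {ω | ∀ k < N, L (n + k) ω ∈ A k} :=
  fun ω ω' hω hA k hk => hω (n + k) (by omega) ▸ hA k hk

lemma eq_biUnion (h : DependsOnPast L ν B) :
    B = ⋃ g ∈ (fun ω (k : Fin ν) => L k ω) '' B, {ω | ∀ k : Fin ν, L k ω = g k} := by
  ext ω
  simp only [mem_iUnion, mem_ofPred_eq, exists_prop]
  refine ⟨fun hω => ⟨_, ⟨ω, hω, rfl⟩, fun _ => rfl⟩, ?_⟩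
  rintro ⟨_, ⟨ω', hω', rfl⟩, hω⟩
  exact h ω' ω (fun k hk => (hω ⟨k, hk⟩).symm) hω'

variable [MeasurableSpace Ω] [Countable α]

lemma measurableSet (hL : ∀ ν l, MeasurableSet {ω | L ν ω = l}) (h : DependsOnPast L ν B) :
    MeasurableSet B := by
  rw [h.eq_biUnion]
  refine MeasurableSet.biUnion (to_countable _) fun g _ => ?_
  rw [ofPred_forall]
  exact MeasurableSet.iInter fun k => hL k (g k)

variable {μ : Measure Ω} {q : ℕ → Ω → PMF α}

/-- As `α` is countable, `B` is a countable disjoint union of histories. On each one the law gives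
conditional probability at least `τ`, and the bounds add up. -/
lemma mul_measure_le (hL : ∀ ν l, MeasurableSet {ω | L ν ω = l})
    (hlaw : ∀ ν ω₀ l, μ {ω | (∀ k < ν, L k ω = L k ω₀) ∧ L ν ω = l} =
      μ {ω | ∀ k < ν, L k ω = L k ω₀} * q ν ω₀ l)
    {τ : ℝ≥0∞} {A : Set α} (hA : ∀ ω, τ ≤ (q ν ω).toOuterMeasure A)
    (h : DependsOnPast L ν B) : τ * μ B ≤ μ (B ∩ {ω | L ν ω ∈ A}) := by
  set H : Ω → Fin ν → α := fun ω k => L k ω with hH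
  have hatom : ∀ g : Fin ν → α, MeasurableSet {ω | ∀ k : Fin ν, L k ω = g k} := fun g => by
    rw [ofPred_forall]
    exact MeasurableSet.iInter fun k => hL k (g k)
  have hval : MeasurableSet {ω | L ν ω ∈ A} :=
    (DependsOnPast.of_value A (Nat.lt_succ_self ν)).measurableSet hL
  have hdisj : (H '' B).PairwiseDisjoint fun g => {ω | ∀ k : Fin ν, L k ω = g k} := by
    intro g _ g' _ hgg'
    refine Set.disjoint_left.2 fun ω hω hω' => hgg' (funext fun k => ?_)
    exact (hω k).symm.trans (hω' k)
  have hB : μ B = ∑' g : H '' B, μ {ω | ∀ k : Fin ν, L k ω = g.1 k} := by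
    conv_lhs => rw [h.eq_biUnion]
    exact measure_biUnion (to_countable _) hdisj fun g _ => hatom g
  have hBA : μ (B ∩ {ω | L ν ω ∈ A}) =
      ∑' g : H '' B, μ ({ω | ∀ k : Fin ν, L k ω = g.1 k} ∩ {ω | L ν ω ∈ A}) := by
    conv_lhs => rw [h.eq_biUnion, iUnion₂_inter]
    exact measure_biUnion (to_countable _)
      (hdisj.mono fun g => inter_subset_left) fun g _ => (hatom g).inter hval
  rw [hB, hBA, ← ENNReal.tsum_mul_left]
  refine ENNReal.tsum_le_tsum ?_
  rintro ⟨_, ω₀, -, rfl⟩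
  have hset : {ω | ∀ k : Fin ν, L k ω = H ω₀ k} = {ω | ∀ k < ν, L k ω = L k ω₀} := by
    ext ω
    exact ⟨fun hω k hk => hω ⟨k, hk⟩, fun hω k => hω k k.2⟩
  simp only [hset]
  have hunion : {ω | ∀ k < ν, L k ω = L k ω₀} ∩ {ω | L ν ω ∈ A} =
      ⋃ l ∈ A, {ω | (∀ k < ν, L k ω = L k ω₀) ∧ L ν ω = l} := by
    ext ω
    simp
  have hmeas : ∀ l, MeasurableSet {ω | (∀ k < ν, L k ω = L k ω₀) ∧ L ν ω = l} := fun l =>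
    (hset ▸ hatom (H ω₀)).inter (hL ν l)
  rw [hunion, measure_biUnion (to_countable A) (fun l _ l' _ hll' => Set.disjoint_left.2
    fun ω hω hω' => hll' (hω.2.symm.trans hω'.2)) fun l _ => hmeas l]
  simp only [hlaw]
  rw [ENNReal.tsum_mul_left, mul_comm τ, tsum_subtype A (q ν ω₀), ← PMF.toOuterMeasure_apply]
  gcongr
  exact hA ω₀

lemma pow_mul_measure_le (hL : ∀ ν l, MeasurableSet {ω | L ν ω = l})
    (hlaw : ∀ ν ω₀ l, μ {ω | (∀ k < ν, L k ω = L k ω₀) ∧ L ν ω = l} =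
      μ {ω | ∀ k < ν, L k ω = L k ω₀} * q ν ω₀ l)
    {τ : ℝ≥0∞} {A : ℕ → Set α} (hA : ∀ ν ω k, τ ≤ (q ν ω).toOuterMeasure (A k))
    (h : DependsOnPast L ν B) (N : ℕ) :
    τ ^ N * μ B ≤ μ (B ∩ {ω | ∀ k < N, L (ν + k) ω ∈ A k}) := by
  induction N with
  | zero => simp
  | succ N ih =>
    have hd := (h.mono (Nat.le_add_right ν N)).inter (forall_value A ν N)
    have hsucc : {ω | ∀ k < N + 1, L (ν + k) ω ∈ A k} =
        {ω | ∀ k < N, L (ν + k) ω ∈ A k} ∩ {ω | L (ν + N) ω ∈ A N} := by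
      ext ω
      exact Nat.forall_lt_succ_right
    rw [hsucc, ← inter_assoc, pow_succ', mul_assoc]
    exact (mul_le_mul_right ih τ).trans (hd.mul_measure_le hL hlaw fun ω => hA _ ω N)

end DependsOnPast

variable [MeasurableSpace Ω] [Countable α] {μ : Measure Ω} [IsProbabilityMeasure μ]
  {q : ℕ → Ω → PMF α}

/-- A pattern of bounded length whose entries have conditional probabilities bounded below occurs
infinitely often. -/
lemma ae_frequently_forall_mem (hL : ∀ ν l, MeasurableSet {ω | L ν ω = l})
    (hlaw : ∀ ν ω₀ l, μ {ω | (∀ k < ν, L k ω = L k ω₀) ∧ L ν ω = l} =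
      μ {ω | ∀ k < ν, L k ω = L k ω₀} * q ν ω₀ l)
    {τ : ℝ≥0∞} (hτ : 0 < τ) {A : ℕ → Set α}
    (hA : ∀ ν ω k, τ ≤ (q ν ω).toOuterMeasure (A k)) (N : ℕ) :
    ∀ᵐ ω ∂μ, ∃ᶠ ν in atTop, ∀ k < N, L (ν + k) ω ∈ A k := by
  set G : ℕ → Set Ω := fun ν => {ω | ∀ k < N, L (ν + k) ω ∈ A k} with hG
  have hGd : ∀ ν, DependsOnPast L (ν + N) (G ν) := fun ν => DependsOnPast.forall_value A ν N
  have key : ∀ n, ∀ᵐ ω ∂μ, ∃ m, ω ∈ G (n + m * N) := by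
    intro n
    -- The pattern fails in the first `m` disjoint blocks after `n`; each further block multiplies
    -- the probability by at most `1 - τ ^ N`.
    set F : ℕ → Set Ω := fun m => {ω | ∀ j < m, ω ∉ G (n + j * N)} with hF
    have hFs : ∀ m, F (m + 1) = F m \ G (n + m * N) := by
      intro m
      ext ω
      exact Nat.forall_lt_succ_right
    have hFd : ∀ m, DependsOnPast L (n + m * N) (F m) := by
      intro m
      induction m with
      | zero => intro ω ω' _ _; simp [hF]
      | succ m ih =>
        have he : n + (m + 1) * N = n + m * N + N := by ring
        rw [hFs, sdiff_eq, he]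
        exact (ih.mono (Nat.le_add_right _ N)).inter (hGd _).compl
    have hle : ∀ m, μ (F m) ≤ (1 - τ ^ N) ^ m := by
      intro m
      induction m with
      | zero => simpa using prob_le_one
      | succ m ih =>
        have h1 := (hFd m).pow_mul_measure_le hL hlaw hA N
        have h2 := measure_inter_add_sdiff (μ := μ) (F m)
          ((hGd (n + m * N)).measurableSet hL)
        have h3 : μ (F (m + 1)) ≤ (1 - τ ^ N) * μ (F m) := by
          rw [hFs, ENNReal.sub_mul fun _ _ => measure_ne_top _ _, one_mul]
          refine ENNReal.le_sub_of_add_le_left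
            (ne_top_of_le_ne_top (measure_ne_top μ _) h1) ?_
          exact (add_le_add h1 le_rfl).trans h2.le
        rw [pow_succ']
        exact h3.trans (by gcongr)
    have hlim : Tendsto (fun m => (1 - τ ^ N) ^ m) atTop (𝓝 0) :=
      ENNReal.tendsto_pow_atTop_nhds_zero_of_lt_one
        (ENNReal.sub_lt_self ENNReal.one_ne_top one_ne_zero (pow_ne_zero N hτ.ne'))
    rw [ae_iff]
    refine le_antisymm (ge_of_tendsto' hlim fun m => ?_) zero_le
    have hsub : {ω | ¬∃ m, ω ∈ G (n + m * N)} ⊆ F m := fun ω hω j _ hj => hω ⟨j, hj⟩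
    exact (measure_mono hsub).trans (hle m)
  filter_upwards [ae_all_iff.2 key] with ω hω
  refine frequently_atTop.2 fun n => ?_
  obtain ⟨m, hm⟩ := hω n
  exact ⟨n + m * N, Nat.le_add_right _ _, hm⟩

lemma ae_forall_mem (hL : ∀ ν l, MeasurableSet {ω | L ν ω = l})
    (hlaw : ∀ ν ω₀ l, μ {ω | (∀ k < ν, L k ω = L k ω₀) ∧ L ν ω = l} =
      μ {ω | ∀ k < ν, L k ω = L k ω₀} * q ν ω₀ l)
    {A : Set α} (hA : ∀ ν ω, (q ν ω).support ⊆ A) : ∀ᵐ ω ∂μ, ∀ ν, L ν ω ∈ A := by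
  refine ae_all_iff.2 fun ν => ?_
  have hd : DependsOnPast L ν (univ : Set Ω) := fun _ _ _ _ => mem_univ _
  have h1 := hd.mul_measure_le hL hlaw (τ := 1) fun ω =>
    (((q ν ω).toOuterMeasure_apply_eq_one_iff A).2 (hA ν ω)).ge
  rw [measure_univ, mul_one, univ_inter] at h1
  exact (mem_ae_iff_prob_eq_one
    ((DependsOnPast.of_value A (Nat.lt_succ_self ν)).measurableSet hL)).2
    (le_antisymm prob_le_one h1)

end Sampling

end ProjectForget

/-! ### From stochastic runs to projection chains. -/

namespace ProjectForget

variable {d : ℕ} {f : EuclideanSpace ℝ (Fin d) → ℝ} {S : Set (EuclideanSpace ℝ (Fin d))}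
  {ι : Type*} {a : ι → EuclideanSpace ℝ (Fin d)} {b : ι → ℝ}

section Flatten

/-- The constraint processed at time `n` when every iteration is given `R + 1` time slots. -/
def flatIndex (R : ℕ) (l : ℕ → List ι) (n : ℕ) : Option ι :=
  (l (n / (R + 1)))[n % (R + 1)]?

/-- The variables at time `n` when every iteration is given `R + 1` time slots. -/
def flatten {α : Type*} (R : ℕ) (l : ℕ → List ι) (x : ℕ → ℕ → α) (n : ℕ) : α :=
  x (n / (R + 1)) (min (n % (R + 1)) (l (n / (R + 1))).length)

variable {R : ℕ} {l : ℕ → List ι}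

lemma slot_div {R ν j : ℕ} (hj : j ≤ R) : (ν * (R + 1) + j) / (R + 1) = ν := by
  rw [mul_comm, Nat.mul_add_div R.succ_pos, Nat.div_eq_of_lt (Nat.lt_succ_of_le hj), add_zero]

lemma slot_mod {R ν j : ℕ} (hj : j ≤ R) : (ν * (R + 1) + j) % (R + 1) = j := by
  rw [mul_comm, Nat.mul_add_mod, Nat.mod_eq_of_lt (Nat.lt_succ_of_le hj)]

lemma flatIndex_slot {ν j : ℕ} (hj : j ≤ R) : flatIndex R l (ν * (R + 1) + j) = (l ν)[j]? := by
  rw [flatIndex, slot_div hj, slot_mod hj]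

lemma flatten_slot {α : Type*} (x : ℕ → ℕ → α) {ν j : ℕ} (hj : j ≤ R) :
    flatten R l x (ν * (R + 1) + j) = x ν (min j (l ν).length) := by
  rw [flatten, slot_div hj, slot_mod hj]

lemma flatten_start {α : Type*} (x : ℕ → ℕ → α) (ν : ℕ) :
    flatten R l x (ν * (R + 1)) = x ν 0 := by
  simpa using flatten_slot (l := l) x (ν := ν) (Nat.zero_le R)

lemma flatten_succ_of_length_le {α : Type*} {x : ℕ → ℕ → α}
    (hx : ∀ ν, x (ν + 1) 0 = x ν (l ν).length) {ν j : ℕ} (hj : j ≤ R) (hlen : (l ν).length ≤ j) :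
    flatten R l x (ν * (R + 1) + j + 1) = flatten R l x (ν * (R + 1) + j) := by
  rw [flatten_slot x hj, min_eq_right hlen]
  rcases hj.eq_or_lt with rfl | hlt
  · rw [← hx, add_assoc, ← Nat.succ_mul, flatten_start]
  · rw [add_assoc, flatten_slot x hlt, min_eq_right (hlen.trans j.le_succ)]

lemma flatten_of_lt_length {α : Type*} (x : ℕ → ℕ → α) (hR : ∀ ν, (l ν).length ≤ R) {ν j : ℕ}
    (hj : j ≤ (l ν).length) : flatten R l x (ν * (R + 1) + j) = x ν j := by
  rw [flatten_slot x (hj.trans (hR ν)), min_eq_left hj]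

/-- With `R + 1` slots for at most `R` projections, the last slot of an iteration is always idle, so
the final point has its own slot and the passage to the next iteration is an idle step. -/
lemma IsTrajectory.isProjectChain [DecidableEq ι] {x : ℕ → ℕ → EuclideanSpace ℝ (Fin d)}
    {z : ℕ → ℕ → ι → ℝ} (h : IsTrajectory f S a b l x z) (hR : ∀ ν, (l ν).length ≤ R) :
    IsProjectChain f S a b (flatIndex R l) (flatten R l x) (flatten R l z) := by
  have hslot : ∀ n, ∃ ν, ∃ j ≤ R, n = ν * (R + 1) + j := fun n =>
    ⟨n / (R + 1), n % (R + 1), Nat.lt_succ_iff.1 (Nat.mod_lt _ R.succ_pos),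
      (Nat.div_add_mod' n (R + 1)).symm⟩
  have hx0 : flatten R l x 0 = x 0 0 := by simpa using flatten_start (l := l) (R := R) x 0
  have hz0 : flatten R l z 0 = z 0 0 := by simpa using flatten_start (l := l) (R := R) z 0
  refine ⟨hx0 ▸ h.init_mem, hx0 ▸ h.init_gradient, hz0 ▸ h.init_dual, fun n hn => ?_,
    fun n i hn => ?_⟩
  · obtain ⟨ν, j, hj, rfl⟩ := hslot n
    rw [flatIndex_slot hj, List.getElem?_eq_none_iff] at hn
    exact ⟨flatten_succ_of_length_le h.next_primal hj hn,
      flatten_succ_of_length_le h.next_dual hj hn⟩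
  · obtain ⟨ν, j, hj, rfl⟩ := hslot n
    rw [flatIndex_slot hj, List.getElem?_eq_some_iff] at hn
    obtain ⟨hlt, rfl⟩ := hn
    rw [add_assoc, flatten_of_lt_length x hR hlt.le, flatten_of_lt_length z hR hlt.le,
      flatten_of_lt_length x hR hlt, flatten_of_lt_length z hR hlt]
    exact h.project ν j hlt

lemma coversAll_flatIndex (hR : ∀ ν, (l ν).length ≤ R) {ν N : ℕ}
    (h : ∀ i, ∃ k < N, i ∈ l (ν + k)) :
    CoversAll (flatIndex R l) (N * (R + 1)) (ν * (R + 1)) := by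
  intro i
  obtain ⟨k, hk, hi⟩ := h i
  obtain ⟨j, hj, hji⟩ := List.getElem_of_mem hi
  have hjR : j ≤ R := hj.le.trans (hR _)
  refine ⟨k * (R + 1) + j, ?_, ?_⟩
  · calc k * (R + 1) + j < (k + 1) * (R + 1) := by rw [Nat.succ_mul]; omega
      _ ≤ N * (R + 1) := Nat.mul_le_mul_right _ hk
  · rw [← add_assoc, ← add_mul, flatIndex_slot hjR, List.getElem?_eq_some_iff]
    exact ⟨hj, hji⟩

end Flatten

/-- If a non-negative sequence contracts by `ρ ^ N` over `N` steps, then it contracts by `ρ` in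
one of these steps. -/
lemma exists_succ_le_mul {e : ℕ → ℝ} {ρ : ℝ} (hρ : 0 ≤ ρ) {ν N : ℕ} (hN : 0 < N)
    (h : e (ν + N) ≤ ρ ^ N * e ν) : ∃ k < N, e (ν + k + 1) ≤ ρ * e (ν + k) := by
  by_contra! hcon
  have hge : ∀ m ≤ N, ρ ^ m * e ν ≤ e (ν + m) := by
    intro m hm
    induction m with
    | zero => simp
    | succ m ih =>
      refine le_trans ?_ (hcon m hm).le
      rw [pow_succ', mul_assoc]
      exact mul_le_mul_of_nonneg_left (ih (Nat.le_of_succ_le hm)) hρ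
  obtain ⟨m, rfl⟩ := Nat.exists_eq_succ_of_ne_zero hN.ne'
  have h1 := hcon m m.lt_succ_self
  have h2 := mul_le_mul_of_nonneg_left (hge m m.le_succ) hρ
  rw [← mul_assoc, ← pow_succ'] at h2
  rw [Nat.succ_eq_add_one, ← add_assoc] at h
  linarith

/-- Almost surely, the lists of a stochastic run have bounded length, and infinitely often the
lists of consecutive iterations contain all the constraints. -/
lemma IsStochasticRun.ae_frequently_covers [Fintype ι] [DecidableEq ι]
    {Q : EuclideanSpace ℝ (Fin d) → PMF (List ι)} {R : ℕ}
    (hR : ∀ x, ∀ l ∈ (Q x).support, l.length ≤ R) {τ : ℝ≥0∞} (hτ : 0 < τ)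
    (hQ : ∀ x i, τ ≤ (Q x).toOuterMeasure {l | i ∈ l}) {Ω : Type*} [MeasurableSpace Ω]
    {μ : Measure Ω} [IsProbabilityMeasure μ] {L : ℕ → Ω → List ι}
    {x : ℕ → ℕ → Ω → EuclideanSpace ℝ (Fin d)} {z : ℕ → ℕ → Ω → ι → ℝ}
    (h : IsStochasticRun f S a b Q μ L x z) :
    ∀ᵐ ω ∂μ, (∀ ν, (L ν ω).length ≤ R) ∧
      ∃ᶠ ν in atTop, ∀ i, ∃ k < Fintype.card ι + 1, i ∈ L (ν + k) ω := by
  have hlaw : ∀ ν ω₀ l, μ {ω | (∀ k < ν, L k ω = L k ω₀) ∧ L ν ω = l} =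
      μ {ω | ∀ k < ν, L k ω = L k ω₀} * (fun ν ω => Q (x ν 0 ω)) ν ω₀ l := h.law
  -- The `k`-th list of the window must contain the `k`-th constraint. The extra last list is
  -- unrestricted; it keeps the window non-empty when there are no constraints.
  set A : ℕ → Set (List ι) := fun k =>
    {l | ∀ hk : k < Fintype.card ι, (Fintype.equivFin ι).symm ⟨k, hk⟩ ∈ l} with hA
  -- The minimum is for the unrestricted entries, of probability `1`: without constraints, `τ` may
  -- exceed `1`.
  have hprob : ∀ ν ω k, min τ 1 ≤ (Q (x ν 0 ω)).toOuterMeasure (A k) := by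
    intro ν ω k
    by_cases hk : k < Fintype.card ι
    · refine (min_le_left _ _).trans ((hQ (x ν 0 ω) ((Fintype.equivFin ι).symm ⟨k, hk⟩)).trans ?_)
      exact (Q (x ν 0 ω)).toOuterMeasure.mono fun l hl _ => hl
    · refine (min_le_right _ _).trans
        (((Q (x ν 0 ω)).toOuterMeasure_apply_eq_one_iff (A k)).2 fun l _ hk' => ?_).ge
      exact absurd hk' hk
  filter_upwards [ae_forall_mem h.measurableSet hlaw (A := {l | l.length ≤ R})
      fun ν ω l hl => hR _ l hl,
    ae_frequently_forall_mem h.measurableSet hlaw (lt_min hτ one_pos) hprob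
      (Fintype.card ι + 1)] with ω hlen hfreq
  refine ⟨hlen, hfreq.mono fun ν hν i => ⟨Fintype.equivFin ι i, by omega, ?_⟩⟩
  have := hν (Fintype.equivFin ι i) (by omega) (Fintype.equivFin ι i).2
  simpa using this

end ProjectForget

/-! ### Almost sure convergence and rate. -/

theorem mainTheorem2 {d : ℕ} {ι : Type*} [Fintype ι] [DecidableEq ι]
    (f : EuclideanSpace ℝ (Fin d) → ℝ) (S : Set (EuclideanSpace ℝ (Fin d)))
    (a : ι → EuclideanSpace ℝ (Fin d)) (b : ι → ℝ)
    (ha : ∀ i, a i ≠ 0)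
    (hf : ProjectForget.IsBregmanFunction f S)
    (hzone : ∀ i, ProjectForget.StronglyZoneConsistent f S (a i) (b i))
    (hfeas : (ProjectForget.feasibleSet S a b).Nonempty)
    (hcrit : ∃ x₀ ∈ S, gradient f x₀ = 0)
    (Q : EuclideanSpace ℝ (Fin d) → PMF (List ι))
    (hQ : ProjectForget.IsRandomSeparationOracle Q) :
    ∃ xopt : EuclideanSpace ℝ (Fin d),
      ProjectForget.IsOptimal f S a b xopt ∧
      (∀ y, ProjectForget.IsOptimal f S a b y → y = xopt) ∧
      -- convergence, along the iterations and along all the projections made within them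
      (∀ (Ω : Type*) [MeasurableSpace Ω] (μ : Measure Ω) [IsProbabilityMeasure μ]
        (L : ℕ → Ω → List ι) (x : ℕ → ℕ → Ω → EuclideanSpace ℝ (Fin d)) (z : ℕ → ℕ → Ω → ι → ℝ),
        ProjectForget.IsStochasticRun f S a b Q μ L x z →
        ∀ᵐ ω ∂μ, ∀ j : ℕ → ℕ, (∀ ν, j ν ≤ (L ν ω).length) →
          Tendsto (fun ν => x ν (j ν) ω) atTop (𝓝 xopt)) ∧
      -- rate; in `ℝ≥0∞`, where `0 / 0 = 0` and `r / 0 = ∞` for `0 < r`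
      (ProjectForget.TwiceDifferentiableAt f xopt →
        (∀ v, v ≠ 0 → 0 < ProjectForget.hessianForm f xopt v) →
        ∃ ρ : ℝ, 0 < ρ ∧ ρ < 1 ∧
          ∀ (Ω : Type*) [MeasurableSpace Ω] (μ : Measure Ω) [IsProbabilityMeasure μ]
            (L : ℕ → Ω → List ι) (x : ℕ → ℕ → Ω → EuclideanSpace ℝ (Fin d))
            (z : ℕ → ℕ → Ω → ι → ℝ),
            ProjectForget.IsStochasticRun f S a b Q μ L x z →
            ∀ᵐ ω ∂μ, liminf (fun ν : ℕ =>
              ENNReal.ofReal (ProjectForget.hessianNorm f xopt (xopt - x (ν + 1) 0 ω)) /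
                ENNReal.ofReal (ProjectForget.hessianNorm f xopt (xopt - x ν 0 ω))) atTop
              ≤ ENNReal.ofReal ρ) := by
  open ProjectForget in
  obtain ⟨xopt, hopt⟩ := hf.exists_isOptimal hfeas hcrit
  obtain ⟨⟨R, hR⟩, τ, hτ, hQτ⟩ := hQ
  have hslots : Tendsto (fun ν => ν * (R + 1)) atTop atTop :=
    tendsto_id.atTop_mul_const' R.succ_pos
  set N := Fintype.card ι + 1 with hN
  refine ⟨xopt, hopt, fun y hy => hf.isOptimal_unique hy hopt, ?_, fun htw hpos => ?_⟩
  · intro Ω _ μ _ L x z hrun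
    filter_upwards [hrun.ae_frequently_covers hR hτ hQτ] with ω ⟨hlen, hcov⟩ j hj
    have hlim := ((hrun.isTrajectory ω).isProjectChain hlen).tendsto_of_frequently_coversAll hf
      hfeas (hslots.frequently (hcov.mono fun ν => coversAll_flatIndex hlen)) hopt
    have hsub : Tendsto (fun ν => ν * (R + 1) + j ν) atTop atTop :=
      tendsto_atTop_mono (fun ν => Nat.le_add_right _ _) hslots
    refine (hlim.comp hsub).congr fun ν => ?_
    exact flatten_of_lt_length _ hlen (hj ν)
  · obtain ⟨r, hr0, hr1, hr⟩ := IsProjectChain.exists_eventually_hessianForm_le hf hopt.1 htw hpos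
      (N * (R + 1))
    have hN2 : 2 * N ≠ 0 := by omega
    -- The factor `r` is for squared norms over `N` iterations, hence the `2 * N`-th root; it was
    -- fixed before any run.
    refine ⟨r ^ (((2 * N : ℕ) : ℝ)⁻¹), Real.rpow_pos_of_pos hr0 _,
      Real.rpow_lt_one hr0.le hr1 (by positivity), fun Ω _ μ _ L x z hrun => ?_⟩
    set ρ := r ^ (((2 * N : ℕ) : ℝ)⁻¹) with hρ
    have hρ0 : 0 ≤ ρ := Real.rpow_nonneg hr0.le _
    have hρr : (ρ ^ N) ^ 2 = r := by
      rw [← pow_mul, mul_comm N 2, hρ, Real.rpow_inv_natCast_pow hr0.le hN2]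
    filter_upwards [hrun.ae_frequently_covers hR hτ hQτ] with ω ⟨hlen, hcov⟩
    have hchain := (hrun.isTrajectory ω).isProjectChain hlen
    have hfreq := hslots.frequently (hcov.mono fun ν => coversAll_flatIndex hlen)
    have hev := hr _ _ _ hchain hfreq (hchain.tendsto_of_frequently_coversAll hf hfeas hfreq hopt)
    set e : ℕ → ℝ := fun ν => hessianNorm f xopt (xopt - x ν 0 ω) with he
    have hform : ∀ ν, hessianForm f xopt (xopt - x ν 0 ω) =
        hessianForm f xopt (x ν 0 ω - xopt) := fun ν => by
      rw [← neg_sub, hessianForm, hessianForm, map_neg, map_neg, neg_apply, neg_neg]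
    have hblock : ∃ᶠ ν in atTop, e (ν + N) ≤ ρ ^ N * e ν := by
      refine (hcov.and_eventually (hslots.eventually hev)).mono fun ν hν => ?_
      have h1 := hν.2 (coversAll_flatIndex hlen hν.1)
      rw [← add_mul, flatten_start, flatten_start] at h1
      have hρN : 0 ≤ ρ ^ N := pow_nonneg hρ0 N
      simp only [he, hessianNorm, hform]
      rw [← Real.sqrt_sq hρN, hρr, ← Real.sqrt_mul hr0.le]
      exact Real.sqrt_le_sqrt h1
    refine liminf_le_of_frequently_le' (frequently_atTop.2 fun n => ?_)
    obtain ⟨ν, hν, hle⟩ := frequently_atTop.1 hblock n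
    -- Some iteration in each such window contracts by `ρ`, which bounds infinitely many quotients
    -- and hence the lower limit.
    obtain ⟨k, -, hk⟩ := exists_succ_le_mul hρ0 (Nat.succ_pos _) hle
    refine ⟨ν + k, hν.trans (Nat.le_add_right _ _), ENNReal.div_le_of_le_mul ?_⟩
    rw [← ENNReal.ofReal_mul hρ0]
    exact ENNReal.ofReal_le_ofReal hk
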